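/- Let $G$ and $T$ be finite groups, let $k$ be a commutative unital ring, and write $Z=Z(G)$. For a finite group $A$, let $kB(A)=k\otimes_{\mathbb Z}B(A)$ be the Burnside group of finite $A$-sets with coefficients in $k$. Conventions: 1. For finite groups $H,K,L$, let $kB_T(H\times K)=kB(H\times K\times T)$. The bilinear composition $\times_K^d: kB_T(H\times K)\times kB_T(K\times L)\to kB_T(H\times L)$ sends $([X],[Y])$ to the class of $X\times_K Y$ (the quotient of $X\times Y$ by $(x,y)\sim((1,h,1)x,(h,1,1)y)$, $h\in K$) with the action $(a,b,t)[x,y]=[(a,1,t)x,(1,b,t)y]$. With $\times_G^d$, $kB_T(G\times G)$ is a $k$-algebra with identity the class of $(G\times G\times T)/(\Delta(G)\times T)$. Let $\mathcal I_T(G)$ be its two-sided ideal generated by all $a\times_K^d b$ with $a\in kB_T(G\times K)$, $b\in kB_T(K\times G)$, $K$ a finite group with $|K|<|G|$. Let $\widehat{kB_T}(G)=kB_T(G\times G)/\mathcal I_T(G)$ (the essential algebra), with quotient map $E_{T,G}$. 2. The monomial Burnside ring $kB^{Z}(T)$ is the $k$-submodule of $kB(T\times Z)$ generated by the classes of the finite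 $(T\times Z)$-sets on which $Z$ acts freely. Its product is the bilinear extension of $[U][V]=[U\times_Z V]$, where $U\times_Z V$ is the quotient of $U\times V$ by $((1,z)u,v)\sim(u,(1,z)v)$ with $(t,z)[u,v]=[(t,z)u,(t,1)v]$. For a subgroup $X\le T$ and a homomorphism $\alpha:X\to Z$, $[X,\alpha]\in kB^Z(T)$ is the class of $(T\times Z)/\{(x,\alpha(x)) : x\in X\}$. 3. For $\tau\in\mathrm{Out}(G)$, let $\tau(U)$ be the set $U$ with the action $(t,z)\cdot u=(t,\tau^{-1}(z))u$; this defines an action of $\mathrm{Out}(G)$ on $kB^Z(T)$ by algebra automorphisms. The algebra $kB^Z(T)\rtimes\mathrm{Out}(G)$ is $\bigoplus_{\sigma\in\mathrm{Out}(G)}kB^Z(T)$, where $u_\sigma$ denotes $u$ in the component $\sigma$, with the product $v_\tau\cdot u_\sigma=(v\,\tau(u))_{\tau\sigma}$. 4. For $\sigma\in\mathrm{Aut}(G)$, $X\le T$ and a homomorphism $\alpha:X\to Z$, let $D_{\sigma,\alpha,X}=\{(\alpha(t)\sigma(g),g,t) : g\in G,\ t\in X\}\le G\times G\times T$. Let $\mathcal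 L_p\subseteq\widehat{kB_T}(G)$ be the set of all $E_{T,G}([(G\times G\times T)/D_{\sigma,\alpha,X}])$. Theorem. There is a homomorphism of unital $k$-algebras $\Phi: kB^{Z}(T)\rtimes\mathrm{Out}(G)\to kB_T(G\times G)$ such that $\Phi([X,\alpha]_{\sigma})=[(G\times G\times T)/D_{\sigma,\alpha,X}]$ for all $X\le T$, all homomorphisms $\alpha:X\to Z$ and all $\sigma\in\mathrm{Aut}(G)$ (on the left, $\sigma$ stands for its class in $\mathrm{Out}(G)$), and $\Phi$ is injective. Moreover, $E_{T,G}\circ\Phi: kB^{Z}(T)\rtimes\mathrm{Out}(G)\to\widehat{kB_T}(G)$ is also injective, and its image is the $k$-subalgebra of $\widehat{kB_T}(G)$ generated by $\mathcal L_p$, which is also the $k$-linear span of $\mathcal L_p$. -/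

import Mathlib

universe u w

/-! ### Finite `A`-sets -/

/-- A finite (left) `A`-set. -/
structure FinGSet (A : Type u) [Group A] where
  carrier : Type u
  [action : MulAction A carrier]
  [fin : Finite carrier]

namespace FinGSet

attribute [instance] FinGSet.action FinGSet.fin

instance (A : Type u) [Group A] : CoeSort (FinGSet A) (Type u) := ⟨FinGSet.carrier⟩

variable {A B : Type u} [Group A] [Group B]

/-- Isomorphism of `A`-sets. -/
def Iso (X Y : FinGSet A) : Prop := ∃ e : X ≃ Y, ∀ (a : A) (x : X), e (a • x) = a • e x

/-- Disjoint union of `A`-sets. -/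
def sum (X Y : FinGSet A) : FinGSet A :=
  letI : MulAction A (X ⊕ Y) :=
    { smul := fun a => Sum.map (a • ·) (a • ·)
      one_smul := by
        rintro (x | y)
        · exact congrArg Sum.inl (one_smul A x)
        · exact congrArg Sum.inr (one_smul A y)
      mul_smul := by
        rintro a b (x | y)
        · exact congrArg Sum.inl (mul_smul a b x)
        · exact congrArg Sum.inr (mul_smul a b y) }
  ⟨X ⊕ Y⟩

/-- The transitive `A`-set `A / D`. -/
def cosets [Finite A] (D : Subgroup A) : FinGSet A := ⟨A ⧸ D⟩

/-- Restriction of the action along a group homomorphism `f : A → B`. -/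
def res (f : A →* B) (X : FinGSet B) : FinGSet A :=
  letI : MulAction A X := MulAction.compHom X f
  ⟨X⟩

/-- A criterion for isomorphism: `X` and `Y` are the same quotient of a common set `W`. -/
theorem Iso.of_surj {X Y : FinGSet A} {W : Type*} (p : W → X) (q : W → Y)
    (hp : Function.Surjective p) (hq : Function.Surjective q)
    (h : ∀ w w', p w = p w' ↔ q w = q w')
    (hs : ∀ (a : A) (w : W), ∃ w', p w' = a • p w ∧ q w' = a • q w) : Iso X Y := by
  choose s hsp using hp
  have key : ∀ w, q (s (p w)) = q w := fun w => (h _ _).1 (hsp _)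
  refine ⟨Equiv.ofBijective (fun x => q (s x)) ⟨?_, ?_⟩, ?_⟩
  · intro x x' hx
    rw [← hsp x, ← hsp x']
    exact (h _ _).2 hx
  · intro y
    obtain ⟨w, rfl⟩ := hq y
    exact ⟨p w, key w⟩
  · intro a x
    obtain ⟨w', h1, h2⟩ := hs a (s x)
    rw [hsp] at h1
    change q (s (a • x)) = a • q (s x)
    rw [← h1, key, h2]

end FinGSet

/-! ### The Burnside module `kB(A)` -/

section Burnside

variable (k : Type w) [CommRing k]
variable {A B P H : Type u} [Group A] [Group B] [Group P] [Group H]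

/-- The defining relations of the Burnside group: isomorphic `A`-sets have the same class,
and the class of a disjoint union is the sum of the classes. -/
def burnsideRel (A : Type u) [Group A] : Set (FinGSet A →₀ k) :=
  {r | ∃ X Y : FinGSet A, FinGSet.Iso X Y ∧
      r = Finsupp.single X 1 - Finsupp.single Y 1} ∪
  {r | ∃ X Y : FinGSet A,
      r = Finsupp.single (X.sum Y) 1 - (Finsupp.single X 1 + Finsupp.single Y 1)}

/-- The Burnside module `kB(A) = k ⊗ B(A)`: the `k`-module generated by the finite `A`-sets
subject to the relations `[X] = [Y]` for `X ≅ Y`, and `[X ⊔ Y] = [X] + [Y]`. -/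
def Burnside (A : Type u) [Group A] : Type (max (u + 1) w) :=
  (FinGSet A →₀ k) ⧸ Submodule.span k (burnsideRel k A)

namespace Burnside

noncomputable instance : AddCommGroup (Burnside k A) :=
  inferInstanceAs (AddCommGroup ((FinGSet A →₀ k) ⧸ Submodule.span k (burnsideRel k A)))

noncomputable instance : Module k (Burnside k A) :=
  inferInstanceAs (Module k ((FinGSet A →₀ k) ⧸ Submodule.span k (burnsideRel k A)))

/-- The class `[X]` of a finite `A`-set `X`. -/
noncomputable def cls (X : FinGSet A) : Burnside k A :=
  Submodule.Quotient.mk (Finsupp.single X 1)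

variable {k}

theorem cls_eq {X Y : FinGSet A} (h : FinGSet.Iso X Y) : cls k X = cls k Y :=
  (Submodule.Quotient.eq _).2 (Submodule.subset_span (Or.inl ⟨X, Y, h, rfl⟩))

theorem cls_sum (X Y : FinGSet A) : cls k (X.sum Y) = cls k X + cls k Y :=
  (Submodule.Quotient.eq _).2 (Submodule.subset_span (Or.inr ⟨X, Y, rfl⟩))

/-- Extend an additive isomorphism invariant of finite `A`-sets to a linear map on `kB(A)`. -/
noncomputable def lift {M : Type*} [AddCommGroup M] [Module k M] (f : FinGSet A → M)
    (hiso : ∀ X Y, FinGSet.Iso X Y → f X = f Y)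
    (hadd : ∀ X Y, f (X.sum Y) = f X + f Y) : Burnside k A →ₗ[k] M :=
  Submodule.liftQ _ (Finsupp.linearCombination k f) (by
    rw [Submodule.span_le]
    rintro _ (⟨X, Y, h, rfl⟩ | ⟨X, Y, rfl⟩)
    · simp [hiso X Y h]
    · simp [hadd X Y])

@[simp] theorem lift_cls {M : Type*} [AddCommGroup M] [Module k M] (f : FinGSet A → M)
    (hiso : ∀ X Y, FinGSet.Iso X Y → f X = f Y)
    (hadd : ∀ X Y, f (X.sum Y) = f X + f Y) (X : FinGSet A) :
    lift (k := k) f hiso hadd (cls k X) = f X := by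
  refine (Submodule.liftQ_apply _ _ _).trans ?_
  simp

theorem hom_ext {M : Type*} [AddCommGroup M] [Module k M] {f g : Burnside k A →ₗ[k] M}
    (h : ∀ X, f (cls k X) = g (cls k X)) : f = g := by
  refine Submodule.linearMap_qext _ (Finsupp.lhom_ext' fun X => LinearMap.ext_ring ?_)
  exact h X

theorem induction {p : Burnside k A → Prop} (x : Burnside k A) (h0 : p 0)
    (ha : ∀ x y, p x → p y → p (x + y)) (hs : ∀ (c : k) x, p x → p (c • x))
    (hc : ∀ X, p (cls k X)) : p x := by
  obtain ⟨f, rfl⟩ := Submodule.Quotient.mk_surjective _ x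
  induction f using Finsupp.induction_linear with
  | zero => exact h0
  | add f g hf hg => exact ha _ _ hf hg
  | single X c =>
    have e : (Finsupp.single X c : FinGSet A →₀ k) = c • Finsupp.single X 1 := by simp
    rw [e]
    exact hs c _ (hc X)

/-- Restriction along a group homomorphism, `kB(B) → kB(A)`. -/
noncomputable def res (f : A →* B) : Burnside k B →ₗ[k] Burnside k A :=
  lift (fun X => cls k (X.res f))
    (fun X Y ⟨e, he⟩ => cls_eq ⟨e, fun a x => he (f a) x⟩)
    (fun X Y => (cls_eq ⟨Equiv.refl _, by rintro a (x | x) <;> rfl⟩).trans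
      (cls_sum (X.res f) (Y.res f)))

@[simp] theorem res_cls (f : A →* B) (X : FinGSet B) : res f (cls k X) = cls k (X.res f) :=
  lift_cls _ _ _ _

end Burnside

/-! ### Balanced products

All products of sets used below are quotients of `X × Y` by the action of a "middle" group `H`,
acted on by another group `P`. -/

/-- The data of a balanced product of an `A`-set and a `B`-set: `H` acts on `X × Y` by
`h • (x, y) = (midL h • x, midR h • y)`, and `P` acts on the set of `H`-orbits by
`s • [x, y] = [actL s • x, actR s • y]`. -/
structure Balancing (H A B P : Type u) [Group H] [Group A] [Group B] [Group P] where
  midL : H →* A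
  midR : H →* B
  actL : P →* A
  actR : P →* B
  commL : ∀ h s, midL h * actL s = actL s * midL h
  commR : ∀ h s, midR h * actR s = actR s * midR h

namespace Balancing

variable (β : Balancing H A B P)

/-- Two pairs are identified when they lie in the same `H`-orbit. -/
def setoid (X : FinGSet A) (Y : FinGSet B) : Setoid (X × Y) where
  r a b := ∃ h : H, β.midL h • a.1 = b.1 ∧ β.midR h • a.2 = b.2
  iseqv :=
    { refl := fun a => ⟨1, by simp, by simp⟩
      symm := by
        rintro ⟨a, b⟩ ⟨c, d⟩ ⟨h, rfl, rfl⟩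
        exact ⟨h⁻¹, by simp, by simp⟩
      trans := by
        rintro ⟨a, b⟩ ⟨c, d⟩ ⟨e, f⟩ ⟨h, rfl, rfl⟩ ⟨h', rfl, rfl⟩
        exact ⟨h' * h, by simp [mul_smul], by simp [mul_smul]⟩ }

/-- The `P`-set of `H`-orbits on `X × Y`. -/
def prod (X : FinGSet A) (Y : FinGSet B) : FinGSet P :=
  letI : MulAction P (Quotient (β.setoid X Y)) :=
    { smul := fun s => Quotient.map (fun a => (β.actL s • a.1, β.actR s • a.2)) (by
        rintro ⟨a, b⟩ ⟨c, d⟩ ⟨h, rfl, rfl⟩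
        refine ⟨h, ?_, ?_⟩
        · simp only [smul_smul, β.commL]
        · simp only [smul_smul, β.commR])
      one_smul := by
        rintro ⟨a, b⟩
        refine congrArg (Quotient.mk _) ?_
        simp
      mul_smul := by
        rintro s t ⟨a, b⟩
        refine congrArg (Quotient.mk _) ?_
        simp [mul_smul] }
  ⟨Quotient (β.setoid X Y)⟩

/-- The class `[x, y]`. -/
def pt {X : FinGSet A} {Y : FinGSet B} (x : X) (y : Y) : β.prod X Y :=
  Quotient.mk (β.setoid X Y) (x, y)

theorem pt_eq {X : FinGSet A} {Y : FinGSet B} {x x' : X} {y y' : Y} :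
    β.pt x y = β.pt x' y' ↔ ∃ h : H, β.midL h • x = x' ∧ β.midR h • y = y' :=
  Quotient.eq (r := β.setoid X Y)

theorem smul_pt {X : FinGSet A} {Y : FinGSet B} (s : P) (x : X) (y : Y) :
    s • β.pt x y = β.pt (β.actL s • x) (β.actR s • y) := rfl

theorem pt_surj {X : FinGSet A} {Y : FinGSet B} (z : β.prod X Y) : ∃ x y, z = β.pt x y := by
  obtain ⟨⟨x, y⟩, rfl⟩ := Quotient.exists_rep z
  exact ⟨x, y, rfl⟩

theorem prod_iso {X X' : FinGSet A} {Y Y' : FinGSet B} (hX : FinGSet.Iso X X')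
    (hY : FinGSet.Iso Y Y') : FinGSet.Iso (β.prod X Y) (β.prod X' Y') := by
  obtain ⟨e, he⟩ := hX
  obtain ⟨f, hf⟩ := hY
  refine FinGSet.Iso.of_surj (W := X × Y) (fun a => β.pt a.1 a.2)
    (fun a => β.pt (e a.1) (f a.2)) ?_ ?_ ?_ ?_
  · intro z
    obtain ⟨x, y, rfl⟩ := β.pt_surj z
    exact ⟨(x, y), rfl⟩
  · intro z
    obtain ⟨x, y, rfl⟩ := β.pt_surj z
    exact ⟨(e.symm x, f.symm y), by simp⟩
  · intro a b
    simp only [pt_eq, ← he, ← hf, e.injective.eq_iff, f.injective.eq_iff]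
  · intro s a
    exact ⟨(β.actL s • a.1, β.actR s • a.2), rfl, by simp only [smul_pt, he, hf]⟩

theorem sum_prod_iso (X X' : FinGSet A) (Y : FinGSet B) :
    FinGSet.Iso (β.prod (X.sum X') Y) ((β.prod X Y).sum (β.prod X' Y)) := by
  refine FinGSet.Iso.of_surj (W := (X × Y) ⊕ (X' × Y))
    (Sum.elim (fun a => β.pt (X := X.sum X') (Sum.inl a.1) a.2)
      (fun a => β.pt (X := X.sum X') (Sum.inr a.1) a.2))
    (Sum.map (fun a => β.pt a.1 a.2) (fun a => β.pt a.1 a.2)) ?_ ?_ ?_ ?_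
  · intro z
    obtain ⟨x | x, y, rfl⟩ := β.pt_surj z
    · exact ⟨Sum.inl (x, y), rfl⟩
    · exact ⟨Sum.inr (x, y), rfl⟩
  · rintro (z | z)
    · obtain ⟨x, y, rfl⟩ := β.pt_surj z
      exact ⟨Sum.inl (x, y), rfl⟩
    · obtain ⟨x, y, rfl⟩ := β.pt_surj z
      exact ⟨Sum.inr (x, y), rfl⟩
  · rintro (a | a) (b | b)
    · refine (β.pt_eq).trans (Iff.trans ?_ (Iff.trans (β.pt_eq (x := a.1) (x' := b.1)).symm
        Sum.inl_injective.eq_iff.symm))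
      exact exists_congr fun h => and_congr_left' Sum.inl_injective.eq_iff
    · refine iff_of_false (fun hh => ?_) (fun hh => by cases hh)
      obtain ⟨h, h1, _⟩ := β.pt_eq.1 hh
      cases h1
    · refine iff_of_false (fun hh => ?_) (fun hh => by cases hh)
      obtain ⟨h, h1, _⟩ := β.pt_eq.1 hh
      cases h1
    · refine (β.pt_eq).trans (Iff.trans ?_ (Iff.trans (β.pt_eq (x := a.1) (x' := b.1)).symm
        Sum.inr_injective.eq_iff.symm))
      exact exists_congr fun h => and_congr_left' Sum.inr_injective.eq_iff
  · rintro s (a | a)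
    · exact ⟨Sum.inl (β.actL s • a.1, β.actR s • a.2), rfl, rfl⟩
    · exact ⟨Sum.inr (β.actL s • a.1, β.actR s • a.2), rfl, rfl⟩

theorem prod_sum_iso (X : FinGSet A) (Y Y' : FinGSet B) :
    FinGSet.Iso (β.prod X (Y.sum Y')) ((β.prod X Y).sum (β.prod X Y')) := by
  refine FinGSet.Iso.of_surj (W := (X × Y) ⊕ (X × Y'))
    (Sum.elim (fun a => β.pt (Y := Y.sum Y') a.1 (Sum.inl a.2))
      (fun a => β.pt (Y := Y.sum Y') a.1 (Sum.inr a.2)))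
    (Sum.map (fun a => β.pt a.1 a.2) (fun a => β.pt a.1 a.2)) ?_ ?_ ?_ ?_
  · intro z
    obtain ⟨x, y | y, rfl⟩ := β.pt_surj z
    · exact ⟨Sum.inl (x, y), rfl⟩
    · exact ⟨Sum.inr (x, y), rfl⟩
  · rintro (z | z)
    · obtain ⟨x, y, rfl⟩ := β.pt_surj z
      exact ⟨Sum.inl (x, y), rfl⟩
    · obtain ⟨x, y, rfl⟩ := β.pt_surj z
      exact ⟨Sum.inr (x, y), rfl⟩
  · rintro (a | a) (b | b)
    · refine (β.pt_eq).trans (Iff.trans ?_ (Iff.trans (β.pt_eq (x := a.1) (x' := b.1)).symm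
        Sum.inl_injective.eq_iff.symm))
      exact exists_congr fun h => and_congr_right' Sum.inl_injective.eq_iff
    · refine iff_of_false (fun hh => ?_) (fun hh => by cases hh)
      obtain ⟨h, _, h1⟩ := β.pt_eq.1 hh
      cases h1
    · refine iff_of_false (fun hh => ?_) (fun hh => by cases hh)
      obtain ⟨h, _, h1⟩ := β.pt_eq.1 hh
      cases h1
    · refine (β.pt_eq).trans (Iff.trans ?_ (Iff.trans (β.pt_eq (x := a.1) (x' := b.1)).symm
        Sum.inr_injective.eq_iff.symm))
      exact exists_congr fun h => and_congr_right' Sum.inr_injective.eq_iff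
  · rintro s (a | a)
    · exact ⟨Sum.inl (β.actL s • a.1, β.actR s • a.2), rfl, rfl⟩
    · exact ⟨Sum.inr (β.actL s • a.1, β.actR s • a.2), rfl, rfl⟩

/-- The bilinear extension `kB(A) × kB(B) → kB(P)` of the balanced product. -/
noncomputable def bilin : Burnside k A →ₗ[k] Burnside k B →ₗ[k] Burnside k P :=
  Burnside.lift
    (fun X => Burnside.lift (fun Y => Burnside.cls k (β.prod X Y))
      (fun _ _ h => Burnside.cls_eq (β.prod_iso ⟨Equiv.refl _, fun _ _ => rfl⟩ h))
      (fun Y Y' => (Burnside.cls_eq (β.prod_sum_iso X Y Y')).trans (Burnside.cls_sum _ _)))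
    (fun X X' h => Burnside.hom_ext fun Y => by
      simpa using Burnside.cls_eq (β.prod_iso h ⟨Equiv.refl _, fun _ _ => rfl⟩))
    (fun X X' => Burnside.hom_ext fun Y => by
      simpa using (Burnside.cls_eq (β.sum_prod_iso X X' Y)).trans (Burnside.cls_sum _ _))

@[simp] theorem bilin_cls (X : FinGSet A) (Y : FinGSet B) :
    β.bilin k (Burnside.cls k X) (Burnside.cls k Y) = Burnside.cls k (β.prod X Y) := by
  simp [bilin]

end Balancing

end Burnside

/-! ### The shifted Burnside functor: composition, endomorphism algebra, essential algebra -/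

section Shifted

/-- `X ×_H^d Y` for a `G × H × T`-set `X` and an `H × K × T`-set `Y`. The right action of `H` on
`X` is `x h = (1, h⁻¹, 1) x`, so `X ×_H Y` is the set of orbits of
`h (x, y) = ((1, h, 1) x, (h, 1, 1) y)`, with `(g, k, t) [x, y] = [(g, 1, t) x, (1, k, t) y]`. -/
def diagBalancing (G H K T : Type u) [Group G] [Group H] [Group K] [Group T] :
    Balancing H (G × H × T) (H × K × T) (G × K × T) where
  midL := { toFun := fun h => (1, h, 1), map_one' := rfl, map_mul' := by simp }
  midR := { toFun := fun h => (h, 1, 1), map_one' := rfl, map_mul' := by simp }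
  actL := { toFun := fun s => (s.1, 1, s.2.2), map_one' := rfl, map_mul' := by simp }
  actR := { toFun := fun s => (1, s.2.1, s.2.2), map_one' := rfl, map_mul' := by simp }
  commL := by simp
  commR := by simp

variable (k : Type w) [CommRing k]

/-- `kB_T(G × H) = kB(G × H × T)`. -/
abbrev ShiftedBurnside (G H T : Type u) [Group G] [Group H] [Group T] : Type (max (u + 1) w) :=
  Burnside k (G × H × T)

/-- The composition `×_H^d : kB_T(G × H) × kB_T(H × K) → kB_T(G × K)`. -/
noncomputable def ShiftedBurnside.comp {G H K T : Type u} [Group G] [Group H] [Group K] [Group T] :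
    ShiftedBurnside k G H T →ₗ[k] ShiftedBurnside k H K T →ₗ[k] ShiftedBurnside k G K T :=
  (diagBalancing G H K T).bilin k

theorem ShiftedBurnside.comp_cls {G H K T : Type u} [Group G] [Group H] [Group K] [Group T]
    (X : FinGSet (G × H × T)) (Y : FinGSet (H × K × T)) :
    comp k (Burnside.cls k X) (Burnside.cls k Y) =
      Burnside.cls k ((diagBalancing G H K T).prod X Y) :=
  Balancing.bilin_cls _ _ _ _

theorem diag_assoc {G H K L T : Type u} [Group G] [Group H] [Group K] [Group L] [Group T]
    (X : FinGSet (G × H × T)) (Y : FinGSet (H × K × T)) (Z : FinGSet (K × L × T)) :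
    FinGSet.Iso
      ((diagBalancing G K L T).prod ((diagBalancing G H K T).prod X Y) Z)
      ((diagBalancing G H L T).prod X ((diagBalancing H K L T).prod Y Z)) := by
  refine FinGSet.Iso.of_surj (W := X × Y × Z)
    (fun a => (diagBalancing G K L T).pt ((diagBalancing G H K T).pt a.1 a.2.1) a.2.2)
    (fun a => (diagBalancing G H L T).pt a.1 ((diagBalancing H K L T).pt a.2.1 a.2.2)) ?_ ?_ ?_ ?_
  · intro z
    obtain ⟨v, z, rfl⟩ := Balancing.pt_surj _ z
    obtain ⟨x, y, rfl⟩ := Balancing.pt_surj _ v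
    exact ⟨(x, y, z), rfl⟩
  · intro z
    obtain ⟨x, v, rfl⟩ := Balancing.pt_surj _ z
    obtain ⟨y, z, rfl⟩ := Balancing.pt_surj _ v
    exact ⟨(x, y, z), rfl⟩
  · rintro ⟨x, y, z⟩ ⟨x', y', z'⟩
    simp only [Balancing.pt_eq, Balancing.smul_pt]
    simp only [diagBalancing, MonoidHom.coe_mk, OneHom.coe_mk, smul_smul]
    constructor
    · rintro ⟨κ, ⟨h, h1, h2⟩, h3⟩
      refine ⟨h, ?_, κ, ?_, ?_⟩
      · rw [← h1]; congr 1; simp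
      · rw [← h2]; congr 1; simp
      · rw [← h3]; congr 1; simp
    · rintro ⟨h, h1, κ, h2, h3⟩
      refine ⟨κ, ⟨h, ?_, ?_⟩, ?_⟩
      · rw [← h1]; congr 1; simp
      · rw [← h2]; congr 1; simp
      · rw [← h3]; congr 1; simp
  · rintro ⟨g, l, t⟩ ⟨x, y, z⟩
    exact ⟨(((g, 1, t) : G × H × T) • x, ((1, 1, t) : H × K × T) • y, ((1, l, t) : K × L × T) • z),
      rfl, rfl⟩

theorem ShiftedBurnside.comp_assoc {G H K L T : Type u} [Group G] [Group H] [Group K] [Group L]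
    [Group T] (a : ShiftedBurnside k G H T) (b : ShiftedBurnside k H K T)
    (c : ShiftedBurnside k K L T) :
    comp k (comp k a b) c = comp k a (comp k b c) := by
  induction a using Burnside.induction with
  | h0 => simp
  | ha x y hx hy => simp [hx, hy]
  | hs r x hx => simp [hx]
  | hc X =>
  induction b using Burnside.induction with
  | h0 => simp
  | ha x y hx hy => simp [hx, hy]
  | hs r x hx => simp [hx]
  | hc Y =>
  induction c using Burnside.induction with
  | h0 => simp
  | ha x y hx hy => simp [hx, hy]
  | hs r x hx => simp [hx]
  | hc Z =>
  simp only [comp_cls]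
  exact Burnside.cls_eq (diag_assoc X Y Z)

/-- The set `G` with `(g₁, g₂, t) x = g₁ x g₂⁻¹`; it is isomorphic to `GGT / (Δ(G) × T)`. -/
def diagUnit (G T : Type u) [Group G] [Group T] [Finite G] : FinGSet (G × G × T) :=
  letI : MulAction (G × G × T) G :=
    { smul := fun s x => s.1 * x * s.2.1⁻¹
      one_smul := fun x => by
        change 1 * x * (1 : G)⁻¹ = x
        simp
      mul_smul := fun s s' x => by
        change s.1 * s'.1 * x * (s.2.1 * s'.2.1)⁻¹ = s.1 * (s'.1 * x * s'.2.1⁻¹) * s.2.1⁻¹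
        group }
  ⟨G⟩

theorem diag_unit_left {G K T : Type u} [Group G] [Group K] [Group T] [Finite G]
    (Y : FinGSet (G × K × T)) :
    FinGSet.Iso ((diagBalancing G G K T).prod (diagUnit G T) Y) Y := by
  refine FinGSet.Iso.of_surj (W := G × Y)
    (fun a => (diagBalancing G G K T).pt (X := diagUnit G T) a.1 a.2)
    (fun a => ((a.1, 1, 1) : G × K × T) • a.2) ?_ ?_ ?_ ?_
  · intro z
    obtain ⟨x, y, rfl⟩ := Balancing.pt_surj _ z
    exact ⟨(x, y), rfl⟩
  · intro y
    exact ⟨(1, y), one_smul (G × K × T) y⟩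
  · rintro ⟨x, y⟩ ⟨x', y'⟩
    refine (Balancing.pt_eq _).trans (Iff.intro ?_ ?_)
    · rintro ⟨h, h1, h2⟩
      have h1 : (1 : G) * x * h⁻¹ = x' := h1
      have h2 : ((h, 1, 1) : G × K × T) • y = y' := h2
      simp only [← h1, ← h2, smul_smul]
      congr 1
      simp
    · intro h
      refine ⟨x'⁻¹ * x, ?_, ?_⟩
      · change (1 : G) * x * (x'⁻¹ * x)⁻¹ = x'
        group
      · change ((x'⁻¹ * x, 1, 1) : G × K × T) • y = y'
        have h : ((x, 1, 1) : G × K × T) • y = ((x', 1, 1) : G × K × T) • y' := h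
        rw [eq_comm, ← inv_smul_eq_iff.2 h, smul_smul]
        congr 1
        simp
  · rintro ⟨g, κ, t⟩ ⟨x, y⟩
    refine ⟨((g * x * (1 : G)⁻¹ : G), ((1, κ, t) : G × K × T) • y), rfl, ?_⟩
    simp only [smul_smul]
    congr 1
    simp

theorem diag_unit_right {G H T : Type u} [Group G] [Group H] [Group T] [Finite G]
    (X : FinGSet (H × G × T)) :
    FinGSet.Iso ((diagBalancing H G G T).prod X (diagUnit G T)) X := by
  refine FinGSet.Iso.of_surj (W := X × G)
    (fun a => (diagBalancing H G G T).pt (Y := diagUnit G T) a.1 a.2)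
    (fun a => ((1, a.2⁻¹, 1) : H × G × T) • a.1) ?_ ?_ ?_ ?_
  · intro z
    obtain ⟨x, y, rfl⟩ := Balancing.pt_surj _ z
    exact ⟨(x, y), rfl⟩
  · intro y
    refine ⟨(y, 1), ?_⟩
    simp only [inv_one]
    exact one_smul (H × G × T) y
  · rintro ⟨x, y⟩ ⟨x', y'⟩
    refine (Balancing.pt_eq _).trans (Iff.intro ?_ ?_)
    · rintro ⟨h, h2, h1⟩
      have h1 : h * y * (1 : G)⁻¹ = y' := h1
      have h2 : ((1, h, 1) : H × G × T) • x = x' := h2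
      simp only [← h1, ← h2, smul_smul]
      congr 1
      simp
    · intro h
      refine ⟨y' * y⁻¹, ?_, ?_⟩
      · change ((1, y' * y⁻¹, 1) : H × G × T) • x = x'
        have h : ((1, y⁻¹, 1) : H × G × T) • x = ((1, y'⁻¹, 1) : H × G × T) • x' := h
        rw [eq_comm, ← inv_smul_eq_iff.2 h, smul_smul]
        congr 1
        simp
      · change y' * y⁻¹ * y * (1 : G)⁻¹ = y'
        group
  · rintro ⟨g, κ, t⟩ ⟨x, y⟩
    refine ⟨(((g, 1, t) : H × G × T) • x, (1 * y * κ⁻¹ : G)), rfl, ?_⟩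
    simp only [smul_smul]
    congr 1
    simp

theorem ShiftedBurnside.unit_comp {G K T : Type u} [Group G] [Group K] [Group T] [Finite G]
    (a : ShiftedBurnside k G K T) : comp k (Burnside.cls k (diagUnit G T)) a = a := by
  induction a using Burnside.induction with
  | h0 => simp
  | ha x y hx hy => simp [hx, hy]
  | hs r x hx => simp [hx]
  | hc X =>
    rw [comp_cls]
    exact Burnside.cls_eq (diag_unit_left X)

theorem ShiftedBurnside.comp_unit {G H T : Type u} [Group G] [Group H] [Group T] [Finite G]
    (a : ShiftedBurnside k H G T) : comp k a (Burnside.cls k (diagUnit G T)) = a := by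
  induction a using Burnside.induction with
  | h0 => simp
  | ha x y hx hy => simp [hx, hy]
  | hs r x hx => simp [hx]
  | hc X =>
    rw [comp_cls]
    exact Burnside.cls_eq (diag_unit_right X)

/-- The endomorphism algebra `kB_T(G × G)`, with product `×_G^d`. -/
def ShiftedEnd (G T : Type u) [Group G] [Group T] : Type (max (u + 1) w) :=
  ShiftedBurnside k G G T

namespace ShiftedEnd

variable (G T : Type u) [Group G] [Group T]

noncomputable instance : AddCommGroup (ShiftedEnd k G T) :=
  inferInstanceAs (AddCommGroup (Burnside k (G × G × T)))

noncomputable instance : Module k (ShiftedEnd k G T) :=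
  inferInstanceAs (Module k (Burnside k (G × G × T)))

variable {G T}

/-- The class `[X]` in `kB_T(G × G)` of a finite `G × G × T`-set `X`. -/
noncomputable def cls (X : FinGSet (G × G × T)) : ShiftedEnd k G T := Burnside.cls k X

noncomputable instance [Finite G] : Ring (ShiftedEnd k G T) :=
  { (inferInstance : AddCommGroup (ShiftedEnd k G T)) with
    mul := fun a b => ShiftedBurnside.comp k (G := G) (H := G) (K := G) (T := T) a b
    one := cls k (diagUnit G T)
    left_distrib := fun a b c => map_add (ShiftedBurnside.comp k (G := G) (T := T) a) b c
    right_distrib := fun a b c =>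
      LinearMap.map_add₂ (ShiftedBurnside.comp k (G := G) (T := T)) a b c
    zero_mul := fun a => LinearMap.map_zero₂ (ShiftedBurnside.comp k (G := G) (T := T)) a
    mul_zero := fun a => map_zero (ShiftedBurnside.comp k (G := G) (T := T) a)
    mul_assoc := fun a b c => ShiftedBurnside.comp_assoc k a b c
    one_mul := fun a => ShiftedBurnside.unit_comp k a
    mul_one := fun a => ShiftedBurnside.comp_unit k a }

noncomputable instance [Finite G] : Algebra k (ShiftedEnd k G T) :=
  Algebra.ofModule
    (fun r a b => LinearMap.map_smul₂ (ShiftedBurnside.comp k (G := G) (T := T)) r a b)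
    (fun r a b => map_smul (ShiftedBurnside.comp k (G := G) (T := T) a) r b)

end ShiftedEnd

variable (G T : Type u) [Group G] [Group T] [Finite G]

/-- The ideal `I_T(G)` of `kB_T(G × G)`, generated by the elements `a ×_K^d b` with
`a ∈ kB_T(G × K)`, `b ∈ kB_T(K × G)` and `K` a finite group with `|K| < |G|`. -/
noncomputable def essentialIdeal : TwoSidedIdeal (ShiftedEnd k G T) :=
  TwoSidedIdeal.span
    {x | ∃ (K : Type u) (_ : Group K) (_ : Finite K), Nat.card K < Nat.card G ∧
      ∃ (a : ShiftedBurnside k G K T) (b : ShiftedBurnside k K G T),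
        x = ShiftedBurnside.comp k a b}

/-- The essential algebra: the quotient of `kB_T(G × G)` by `I_T(G)`. -/
abbrev EssentialAlgebra : Type (max (u + 1) w) :=
  ShiftedEnd k G T ⧸ (essentialIdeal k G T).asIdeal

/-- The quotient map `E_{T,G}` from `kB_T(G × G)` to the essential algebra. -/
noncomputable def essentialMap : ShiftedEnd k G T →ₐ[k] EssentialAlgebra k G T :=
  Ideal.Quotient.mkₐ k (essentialIdeal k G T).asIdeal

end Shifted

/-! ### The monomial Burnside ring -/

section Monomial

variable (k : Type w) [CommRing k] (T C : Type u) [Group T] [CommGroup C]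

/-- `X ×_C Y` for `T × C`-sets `X` and `Y`: the set of orbits of `C` on `X × Y`, where `c` sends
`(x, y)` to `(x c⁻¹, c y)`, with `(t, c) [x, y] = [(t, c) x, (t, 1) y]`. -/
def fibreBalancing : Balancing C (T × C) (T × C) (T × C) where
  midL := { toFun := fun c => (1, c⁻¹), map_one' := by simp, map_mul' := by simp [mul_comm] }
  midR := { toFun := fun c => (1, c), map_one' := rfl, map_mul' := by simp }
  actL := MonoidHom.id _
  actR := { toFun := fun s => (s.1, 1), map_one' := rfl, map_mul' := by simp }
  commL := fun h s => by ext <;> simp [mul_comm]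
  commR := by simp

variable {T C} in
theorem fibre_assoc (X Y Z : FinGSet (T × C)) :
    FinGSet.Iso
      ((fibreBalancing T C).prod ((fibreBalancing T C).prod X Y) Z)
      ((fibreBalancing T C).prod X ((fibreBalancing T C).prod Y Z)) := by
  refine FinGSet.Iso.of_surj (W := X × Y × Z)
    (fun a => (fibreBalancing T C).pt ((fibreBalancing T C).pt a.1 a.2.1) a.2.2)
    (fun a => (fibreBalancing T C).pt a.1 ((fibreBalancing T C).pt a.2.1 a.2.2)) ?_ ?_ ?_ ?_
  · intro z
    obtain ⟨v, z, rfl⟩ := Balancing.pt_surj _ z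
    obtain ⟨x, y, rfl⟩ := Balancing.pt_surj _ v
    exact ⟨(x, y, z), rfl⟩
  · intro z
    obtain ⟨x, v, rfl⟩ := Balancing.pt_surj _ z
    obtain ⟨y, z, rfl⟩ := Balancing.pt_surj _ v
    exact ⟨(x, y, z), rfl⟩
  · rintro ⟨x, y, z⟩ ⟨x', y', z'⟩
    simp only [Balancing.pt_eq, Balancing.smul_pt]
    simp only [fibreBalancing, MonoidHom.coe_mk, OneHom.coe_mk, smul_smul, MonoidHom.id_apply]
    constructor
    · rintro ⟨c, ⟨d, h1, h2⟩, h3⟩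
      refine ⟨d * c, ?_, c, ?_, ?_⟩
      · rw [← h1]; congr 1; simp [mul_comm]
      · rw [← h2]; congr 1; simp [mul_comm]
      · rw [← h3]; congr 1; simp
    · rintro ⟨c, h1, d, h2, h3⟩
      refine ⟨d, ⟨c * d⁻¹, ?_, ?_⟩, ?_⟩
      · rw [← h1]; congr 1; simp
      · rw [← h2]; congr 1; simp [mul_comm]
      · rw [← h3]; congr 1; simp
  · rintro ⟨t, c⟩ ⟨x, y, z⟩
    exact ⟨(((t, c) : T × C) • x, ((t, 1) : T × C) • y, ((t, 1) : T × C) • z), rfl, rfl⟩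

/-- The trivial `C`-fibred `T`-set `C`. -/
def fibreUnit [Finite C] : FinGSet (T × C) :=
  letI : MulAction (T × C) C := MulAction.compHom C (MonoidHom.snd T C)
  ⟨C⟩

variable {T C} in
theorem fibre_unit_left [Finite C] (Y : FinGSet (T × C)) :
    FinGSet.Iso ((fibreBalancing T C).prod (fibreUnit T C) Y) Y := by
  refine FinGSet.Iso.of_surj (W := C × Y)
    (fun a => (fibreBalancing T C).pt (X := fibreUnit T C) a.1 a.2)
    (fun a => ((1, a.1) : T × C) • a.2) ?_ ?_ ?_ ?_
  · intro z
    obtain ⟨x, y, rfl⟩ := Balancing.pt_surj _ z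
    exact ⟨(x, y), rfl⟩
  · intro y
    exact ⟨(1, y), one_smul (T × C) y⟩
  · rintro ⟨x, y⟩ ⟨x', y'⟩
    refine (Balancing.pt_eq _).trans (Iff.intro ?_ ?_)
    · rintro ⟨c, h1, h2⟩
      have h1 : c⁻¹ * x = x' := h1
      have h2 : ((1, c) : T × C) • y = y' := h2
      simp only [← h1, ← h2, smul_smul]
      congr 1
      simp [mul_comm]
    · intro h
      refine ⟨x * x'⁻¹, ?_, ?_⟩
      · change (x * x'⁻¹)⁻¹ * x = x'
        simp
      · change ((1, x * x'⁻¹) : T × C) • y = y'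
        have h : ((1, x) : T × C) • y = ((1, x') : T × C) • y' := h
        rw [eq_comm, ← inv_smul_eq_iff.2 h, smul_smul]
        congr 1
        simp [mul_comm]
  · rintro ⟨t, c⟩ ⟨x, y⟩
    refine ⟨((c * x : C), ((t, 1) : T × C) • y), rfl, ?_⟩
    simp only [smul_smul]
    congr 1
    simp

variable {T C} in
theorem fibre_unit_right [Finite C] (X : FinGSet (T × C)) :
    FinGSet.Iso ((fibreBalancing T C).prod X (fibreUnit T C)) X := by
  refine FinGSet.Iso.of_surj (W := X × C)
    (fun a => (fibreBalancing T C).pt (Y := fibreUnit T C) a.1 a.2)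
    (fun a => ((1, a.2) : T × C) • a.1) ?_ ?_ ?_ ?_
  · intro z
    obtain ⟨x, y, rfl⟩ := Balancing.pt_surj _ z
    exact ⟨(x, y), rfl⟩
  · intro y
    exact ⟨(y, 1), one_smul (T × C) y⟩
  · rintro ⟨x, y⟩ ⟨x', y'⟩
    refine (Balancing.pt_eq _).trans (Iff.intro ?_ ?_)
    · rintro ⟨c, h2, h1⟩
      have h1 : c * y = y' := h1
      have h2 : ((1, c⁻¹) : T × C) • x = x' := h2
      simp only [← h1, ← h2, smul_smul]
      congr 1
      simp [mul_comm]
    · intro h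
      refine ⟨y' * y⁻¹, ?_, ?_⟩
      · change ((1, (y' * y⁻¹)⁻¹) : T × C) • x = x'
        have h : ((1, y) : T × C) • x = ((1, y') : T × C) • x' := h
        rw [eq_comm, ← inv_smul_eq_iff.2 h, smul_smul]
        congr 1
        simp [mul_comm]
      · change y' * y⁻¹ * y = y'
        simp
  · rintro ⟨t, c⟩ ⟨x, y⟩
    refine ⟨(((t, c) : T × C) • x, (1 * y : C)), rfl, ?_⟩
    simp only [smul_smul]
    congr 1
    simp [mul_comm]

variable {T C} in
theorem fibre_bilin_assoc (a b c : Burnside k (T × C)) :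
    (fibreBalancing T C).bilin k ((fibreBalancing T C).bilin k a b) c =
      (fibreBalancing T C).bilin k a ((fibreBalancing T C).bilin k b c) := by
  induction a using Burnside.induction with
  | h0 => simp
  | ha x y hx hy => simp [hx, hy]
  | hs r x hx => simp [hx]
  | hc X =>
  induction b using Burnside.induction with
  | h0 => simp
  | ha x y hx hy => simp [hx, hy]
  | hs r x hx => simp [hx]
  | hc Y =>
  induction c using Burnside.induction with
  | h0 => simp
  | ha x y hx hy => simp only [map_add, hx, hy]
  | hs r x hx => simp only [map_smul, hx]
  | hc Z =>
  simp only [Balancing.bilin_cls]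
  exact Burnside.cls_eq (fibre_assoc X Y Z)

variable {T C} in
theorem fibre_bilin_one_left [Finite C] (a : Burnside k (T × C)) :
    (fibreBalancing T C).bilin k (Burnside.cls k (fibreUnit T C)) a = a := by
  induction a using Burnside.induction with
  | h0 => simp
  | ha x y hx hy => simp [hx, hy]
  | hs r x hx => simp [hx]
  | hc X =>
    rw [Balancing.bilin_cls]
    exact Burnside.cls_eq (fibre_unit_left X)

variable {T C} in
theorem fibre_bilin_one_right [Finite C] (a : Burnside k (T × C)) :
    (fibreBalancing T C).bilin k a (Burnside.cls k (fibreUnit T C)) = a := by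
  induction a using Burnside.induction with
  | h0 => simp
  | ha x y hx hy => simp [hx, hy]
  | hs r x hx => simp [hx]
  | hc X =>
    rw [Balancing.bilin_cls]
    exact Burnside.cls_eq (fibre_unit_right X)

/-- The module `kB(T × C)`, with the bilinear product extending `(X, Y) ↦ X ×_C Y`. The monomial
Burnside ring is the subring of it spanned by the `C`-free sets. -/
def FibreAlgebra : Type (max (u + 1) w) := Burnside k (T × C)

namespace FibreAlgebra

noncomputable instance : AddCommGroup (FibreAlgebra k T C) :=
  inferInstanceAs (AddCommGroup (Burnside k (T × C)))

noncomputable instance : Module k (FibreAlgebra k T C) :=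
  inferInstanceAs (Module k (Burnside k (T × C)))

variable {T C}

/-- The class `[X]` of a finite `T × C`-set `X`. -/
noncomputable def cls (X : FinGSet (T × C)) : FibreAlgebra k T C := Burnside.cls k X

variable [Finite C]

noncomputable instance : Ring (FibreAlgebra k T C) :=
  { (inferInstance : AddCommGroup (FibreAlgebra k T C)) with
    mul := fun a b => (fibreBalancing T C).bilin k a b
    one := cls k (fibreUnit T C)
    left_distrib := fun a b c => map_add ((fibreBalancing T C).bilin k a) b c
    right_distrib := fun a b c => LinearMap.map_add₂ ((fibreBalancing T C).bilin k) a b c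
    zero_mul := fun a => LinearMap.map_zero₂ ((fibreBalancing T C).bilin k) a
    mul_zero := fun a => map_zero ((fibreBalancing T C).bilin k a)
    mul_assoc := fun a b c => fibre_bilin_assoc k a b c
    one_mul := fun a => fibre_bilin_one_left k a
    mul_one := fun a => fibre_bilin_one_right k a }

noncomputable instance : Algebra k (FibreAlgebra k T C) :=
  Algebra.ofModule
    (fun r a b => LinearMap.map_smul₂ ((fibreBalancing T C).bilin k) r a b)
    (fun r a b => map_smul ((fibreBalancing T C).bilin k a) r b)

theorem cls_mul_cls (X Y : FinGSet (T × C)) :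
    cls k X * cls k Y = cls k ((fibreBalancing T C).prod X Y) :=
  Balancing.bilin_cls _ _ _ _

end FibreAlgebra

variable {T C} in
/-- `X` is a `C`-fibred `T`-set: `C` acts freely on it. -/
def IsFibred (X : FinGSet (T × C)) : Prop :=
  ∀ (c : C) (x : X), ((1, c) : T × C) • x = x → c = 1

theorem isFibred_unit [Finite C] : IsFibred (fibreUnit T C) := fun c x h => by
  exact mul_eq_right.1 (show c * (show C from x) = x from h)

variable {T C} in
theorem isFibred_prod {X Y : FinGSet (T × C)} (hX : IsFibred X) (hY : IsFibred Y) :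
    IsFibred ((fibreBalancing T C).prod X Y) := by
  intro c z h
  obtain ⟨x, y, rfl⟩ := Balancing.pt_surj _ z
  rw [Balancing.smul_pt, Balancing.pt_eq] at h
  obtain ⟨d, h1, h2⟩ := h
  simp only [fibreBalancing, MonoidHom.coe_mk, OneHom.coe_mk, MonoidHom.id_apply, smul_smul]
    at h1 h2
  have hd : d = 1 := hY d y (by simpa using h2)
  subst hd
  exact hX c x (by simpa using h1)

/-- The monomial Burnside ring `kB^C(T)`: the submodule of `kB(T × C)` generated by the classes of
the `C`-fibred `T`-sets, with the product `[X] [Y] = [X ×_C Y]`. -/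
noncomputable def monomialBurnside [Finite C] : Subalgebra k (FibreAlgebra k T C) :=
  (Submodule.span k {x | ∃ X : FinGSet (T × C), IsFibred X ∧ x = FibreAlgebra.cls k X}).toSubalgebra
    (Submodule.subset_span ⟨fibreUnit T C, isFibred_unit T C, rfl⟩)
    (by
      intro x y hx hy
      induction hx, hy using Submodule.span_induction₂ with
      | mem_mem x y hx hy =>
        obtain ⟨X, hX, rfl⟩ := hx
        obtain ⟨Y, hY, rfl⟩ := hy
        exact Submodule.subset_span ⟨_, isFibred_prod hX hY, FibreAlgebra.cls_mul_cls k X Y⟩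
      | zero_left y hy => simp
      | zero_right x hx => simp
      | add_left x y z _ _ _ h1 h2 => rw [add_mul]; exact add_mem h1 h2
      | add_right x y z _ _ _ h1 h2 => rw [mul_add]; exact add_mem h1 h2
      | smul_left r x y _ _ h => rw [smul_mul_assoc]; exact Submodule.smul_mem _ r h
      | smul_right r x y _ _ h => rw [mul_smul_comm]; exact Submodule.smul_mem _ r h)

/-- The type of elements of `kB^C(T)`. -/
def MonomialBurnside [Finite C] : Type (max (u + 1) w) := monomialBurnside k T C

noncomputable instance [Finite C] : Ring (MonomialBurnside k T C) :=
  inferInstanceAs (Ring (monomialBurnside k T C))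

noncomputable instance [Finite C] : Algebra k (MonomialBurnside k T C) :=
  inferInstanceAs (Algebra k (monomialBurnside k T C))

variable {T C}

/-- The inclusion of `kB^C(T)` into `kB(T × C)`. -/
noncomputable def MonomialBurnside.val [Finite C] : MonomialBurnside k T C →ₐ[k] FibreAlgebra k T C :=
  (monomialBurnside k T C).val

/-- The class in `kB^C(T)` of a `C`-fibred `T`-set. -/
noncomputable def MonomialBurnside.cls [Finite C] (X : FinGSet (T × C)) (hX : IsFibred X) :
    MonomialBurnside k T C :=
  ⟨FibreAlgebra.cls k X, Submodule.subset_span ⟨X, hX, rfl⟩⟩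

/-- The subgroup `X_α = {(x, α(x)) | x ∈ X}` of `T × C`. -/
def graphSubgroup (X : Subgroup T) (α : X →* C) : Subgroup (T × C) :=
  (X.subtype.prod α).range

variable [Finite T] [Finite C]

theorem isFibred_transitive (X : Subgroup T) (α : X →* C) :
    IsFibred (FinGSet.cosets (graphSubgroup X α)) := by
  intro c x h
  obtain ⟨⟨t, d⟩, rfl⟩ := QuotientGroup.mk_surjective (s := graphSubgroup X α) x
  have h : (QuotientGroup.mk ((1, c) * (t, d)) : (T × C) ⧸ graphSubgroup X α) =
    QuotientGroup.mk (t, d) := h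
  rw [eq_comm, QuotientGroup.eq] at h
  obtain ⟨x, hx⟩ := h
  have h1 : (x : T) = t⁻¹ * (1 * t) := congrArg Prod.fst hx
  have h2 : α x = d⁻¹ * (c * d) := congrArg Prod.snd hx
  have hx1 : x = 1 := Subtype.ext (by simpa using h1)
  subst hx1
  rw [map_one] at h2
  simpa [mul_comm] using h2.symm

/-- The class `[X, α]` of the transitive `C`-fibred `T`-set `(T × C) / X_α`. -/
noncomputable def MonomialBurnside.transitive (X : Subgroup T) (α : X →* C) :
    MonomialBurnside k T C :=
  MonomialBurnside.cls k (FinGSet.cosets (graphSubgroup X α)) (isFibred_transitive X α)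

end Monomial

/-! ### The twist by automorphisms of the fibre -/

section Twist

variable {k : Type w} [CommRing k] {T C : Type u} [Group T] [CommGroup C]

variable (T) in
/-- The homomorphism `(t, c) ↦ (t, φ⁻¹(c))`. -/
def twistHom (φ : MulAut C) : T × C →* T × C where
  toFun s := (s.1, φ⁻¹ s.2)
  map_one' := by simp
  map_mul' := by simp

/-- The set `φ(U)`, which is `U` with the action `(t, c) · u = (t, φ⁻¹(c)) u`. -/
def FinGSet.twist (φ : MulAut C) (U : FinGSet (T × C)) : FinGSet (T × C) :=
  U.res (twistHom T φ)

theorem isFibred_twist (φ : MulAut C) {U : FinGSet (T × C)} (hU : IsFibred U) :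
    IsFibred (U.twist φ) := fun c u h => by
  have h1 : φ⁻¹ c = 1 := hU (φ⁻¹ c) u h
  simpa using h1

theorem twist_prod (φ : MulAut C) (U V : FinGSet (T × C)) :
    FinGSet.Iso (((fibreBalancing T C).prod U V).twist φ)
      ((fibreBalancing T C).prod (U.twist φ) (V.twist φ)) := by
  refine FinGSet.Iso.of_surj (W := U × V)
    (fun a => (fibreBalancing T C).pt a.1 a.2)
    (fun a => (fibreBalancing T C).pt (X := U.twist φ) (Y := V.twist φ) a.1 a.2) ?_ ?_ ?_ ?_
  · intro z
    obtain ⟨x, y, rfl⟩ := Balancing.pt_surj (X := U) (Y := V) _ z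
    exact ⟨(x, y), rfl⟩
  · intro z
    obtain ⟨x, y, rfl⟩ := Balancing.pt_surj _ z
    exact ⟨(x, y), rfl⟩
  · rintro ⟨x, y⟩ ⟨x', y'⟩
    refine (Balancing.pt_eq _).trans (Iff.trans ?_ (Balancing.pt_eq _).symm)
    constructor
    · rintro ⟨c, h1, h2⟩
      refine ⟨φ c, ?_, ?_⟩
      · have h1 : ((1, c⁻¹) : T × C) • x = x' := h1
        change ((1, φ⁻¹ (φ c)⁻¹) : T × C) • x = x'
        simpa using h1
      · have h2 : ((1, c) : T × C) • y = y' := h2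
        change ((1, φ⁻¹ (φ c)) : T × C) • y = y'
        simpa using h2
    · rintro ⟨c, h1, h2⟩
      refine ⟨φ⁻¹ c, ?_, ?_⟩
      · have h1 : ((1, φ⁻¹ c⁻¹) : T × C) • x = x' := h1
        change ((1, (φ⁻¹ c)⁻¹) : T × C) • x = x'
        simpa using h1
      · exact h2
  · rintro ⟨t, c⟩ ⟨x, y⟩
    refine ⟨(((t, φ⁻¹ c) : T × C) • x, ((t, 1) : T × C) • y), rfl, ?_⟩
    refine congrArg ((fibreBalancing T C).pt (X := U.twist φ) (Y := V.twist φ) _) ?_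
    change ((t, 1) : T × C) • y = ((t, φ⁻¹ 1) : T × C) • y
    rw [map_one]

theorem twist_unit [Finite C] (φ : MulAut C) :
    FinGSet.Iso ((fibreUnit T C).twist φ) (fibreUnit T C) := by
  refine ⟨φ.toEquiv, ?_⟩
  rintro ⟨t, c⟩ x
  change φ (φ⁻¹ c * (show C from x)) = c * φ (show C from x)
  rw [map_mul, MulAut.apply_inv_self]

/-- The linear map `kB(T × C) → kB(T × C)` with `[U] ↦ [φ(U)]`. -/
noncomputable def FibreAlgebra.twist (φ : MulAut C) :
    FibreAlgebra k T C →ₗ[k] FibreAlgebra k T C :=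
  Burnside.res (k := k) (twistHom T φ)

namespace FibreAlgebra

theorem twist_cls (φ : MulAut C) (U : FinGSet (T × C)) :
    twist φ (cls k U) = cls k (U.twist φ) :=
  Burnside.res_cls _ _

theorem res_id (f : T × C →* T × C) (hf : ∀ s, f s = s) (x : Burnside k (T × C)) :
    Burnside.res f x = x := by
  induction x using Burnside.induction with
  | h0 => simp
  | ha x y hx hy => simp [hx, hy]
  | hs r x hx => simp [hx]
  | hc U =>
    rw [Burnside.res_cls]
    refine Burnside.cls_eq ⟨Equiv.refl _, fun s u => ?_⟩
    change f s • (show U from u) = s • (show U from u)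
    rw [hf]

theorem res_res (e f g : T × C →* T × C) (h : ∀ s, f (e s) = g s) (x : Burnside k (T × C)) :
    Burnside.res e (Burnside.res f x) = Burnside.res g x := by
  induction x using Burnside.induction with
  | h0 => simp
  | ha x y hx hy => simp [hx, hy]
  | hs r x hx => simp [hx]
  | hc U =>
    simp only [Burnside.res_cls]
    refine Burnside.cls_eq ⟨Equiv.refl _, fun s u => ?_⟩
    change f (e s) • (show U from u) = g s • (show U from u)
    rw [h]

theorem twist_one_left (x : FibreAlgebra k T C) : twist 1 x = x :=
  res_id _ (fun _ => rfl) x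

theorem twist_twist (φ ψ : MulAut C) (x : FibreAlgebra k T C) :
    twist φ (twist ψ x) = twist (φ * ψ) x :=
  res_res _ _ _ (fun s => by simp [twistHom, mul_inv_rev]) x

variable [Finite C]

theorem twist_one (φ : MulAut C) : twist φ (1 : FibreAlgebra k T C) = 1 :=
  (twist_cls φ _).trans (Burnside.cls_eq (twist_unit φ))

theorem twist_mul (φ : MulAut C) (x y : FibreAlgebra k T C) :
    twist φ (x * y) = twist φ x * twist φ y := by
  induction x using Burnside.induction with
  | h0 =>
    change twist φ ((0 : FibreAlgebra k T C) * y) = twist φ (0 : FibreAlgebra k T C) * twist φ y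
    rw [zero_mul, map_zero, zero_mul]
  | ha x x' hx hx' =>
    let a : FibreAlgebra k T C := x
    let b : FibreAlgebra k T C := x'
    change twist φ ((a + b) * y) = twist φ (a + b) * twist φ y
    rw [add_mul, map_add, map_add, add_mul]
    exact congrArg₂ _ hx hx'
  | hs r x hx =>
    let a : FibreAlgebra k T C := x
    change twist φ ((r • a) * y) = twist φ (r • a) * twist φ y
    rw [smul_mul_assoc, map_smul, map_smul, smul_mul_assoc]
    exact congrArg _ hx
  | hc U =>
  change twist φ (cls k U * y) = twist φ (cls k U) * twist φ y
  induction y using Burnside.induction with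
  | h0 =>
    change twist φ (cls k U * (0 : FibreAlgebra k T C)) =
      twist φ (cls k U) * twist φ (0 : FibreAlgebra k T C)
    rw [mul_zero, map_zero, mul_zero]
  | ha x x' hx hx' =>
    let a : FibreAlgebra k T C := x
    let b : FibreAlgebra k T C := x'
    change twist φ (cls k U * (a + b)) = twist φ (cls k U) * twist φ (a + b)
    rw [mul_add, map_add, map_add, mul_add]
    exact congrArg₂ _ hx hx'
  | hs r x hx =>
    let a : FibreAlgebra k T C := x
    change twist φ (cls k U * (r • a)) = twist φ (cls k U) * twist φ (r • a)
    rw [mul_smul_comm, map_smul, map_smul, mul_smul_comm]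
    exact congrArg _ hx
  | hc V =>
  change twist φ (cls k U * cls k V) = twist φ (cls k U) * twist φ (cls k V)
  rw [cls_mul_cls, twist_cls, twist_cls, twist_cls, cls_mul_cls]
  exact Burnside.cls_eq (twist_prod φ U V)

theorem twist_mem (φ : MulAut C) {x : FibreAlgebra k T C} (hx : x ∈ monomialBurnside k T C) :
    twist φ x ∈ monomialBurnside k T C := by
  change x ∈ Submodule.span k
    {x | ∃ X : FinGSet (T × C), IsFibred X ∧ x = FibreAlgebra.cls k X} at hx
  induction hx using Submodule.span_induction with
  | mem x hx =>
    obtain ⟨U, hU, rfl⟩ := hx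
    rw [twist_cls]
    exact (MonomialBurnside.cls k _ (isFibred_twist φ hU)).2
  | zero => rw [map_zero]; exact zero_mem _
  | add x y _ _ h1 h2 => rw [map_add]; exact add_mem h1 h2
  | smul r x _ h => rw [map_smul]; exact Subalgebra.smul_mem _ h r

end FibreAlgebra

/-- The action of `Aut(C)` on `kB^C(T)` by ring automorphisms, `φ • [U] = [φ(U)]`. -/
noncomputable instance [Finite C] : MulSemiringAction (MulAut C) (MonomialBurnside k T C) where
  smul φ x := ⟨FibreAlgebra.twist φ x.1, FibreAlgebra.twist_mem φ x.2⟩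
  one_smul x := Subtype.ext (FibreAlgebra.twist_one_left x.1)
  mul_smul φ ψ x := Subtype.ext (FibreAlgebra.twist_twist φ ψ x.1).symm
  smul_zero _ := Subtype.ext (map_zero _)
  smul_add _ x y := Subtype.ext (map_add _ x.1 y.1)
  smul_one φ := Subtype.ext (FibreAlgebra.twist_one φ)
  smul_mul φ x y := Subtype.ext (FibreAlgebra.twist_mul φ x.1 y.1)

theorem MonomialBurnside.val_smul [Finite C] (φ : MulAut C) (x : MonomialBurnside k T C) :
    val k (φ • x) = FibreAlgebra.twist φ (val k x) := rfl

end Twist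

/-! ### Outer automorphisms and the algebra `kB^{Z(G)}(T) ⋊ Out(G)` -/

section Crossed

instance innerNormal (G : Type u) [Group G] : ((MulAut.conj : G →* MulAut G).range).Normal where
  conj_mem := by
    rintro _ ⟨g, rfl⟩ σ
    refine ⟨σ g, ?_⟩
    ext x
    simp [MulAut.conj_apply]

/-- The center of a group is a commutative group. -/
instance centerCommGroup (G : Type u) [Group G] : CommGroup (Subgroup.center G) :=
  { (inferInstance : Group (Subgroup.center G)) with
    mul_comm := fun a b => Subtype.ext (Subgroup.mem_center_iff.1 b.2 a) }

/-- `Out(G) = Aut(G) / Inn(G)`. -/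
abbrev OuterAut (G : Type u) [Group G] : Type u :=
  MulAut G ⧸ (MulAut.conj : G →* MulAut G).range

/-- Restriction of automorphisms of `G` to its center. -/
def autCenter (G : Type u) [Group G] : MulAut G →* MulAut (Subgroup.center G) where
  toFun σ := Subgroup.centerCongr σ
  map_one' := by ext; rfl
  map_mul' _ _ := by ext; rfl

/-- The homomorphism `Out(G) → Aut(Z(G))` induced by restriction to the center. -/
def outCenter (G : Type u) [Group G] : OuterAut G →* MulAut (Subgroup.center G) :=
  QuotientGroup.lift _ (autCenter G) (by
    rintro _ ⟨g, rfl⟩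
    ext z
    change g * (z : G) * g⁻¹ = z
    rw [Subgroup.mem_center_iff.1 z.2 g, mul_inv_cancel_right])

variable (k : Type w) [CommRing k] (G T : Type u) [Group G] [Group T] [Finite G]

noncomputable instance : MulSemiringAction (OuterAut G)
    (MonomialBurnside k T (Subgroup.center G)) :=
  MulSemiringAction.compHom _ (outCenter G)

instance : SMulCommClass (OuterAut G) k (MonomialBurnside k T (Subgroup.center G)) where
  smul_comm σ r x := Subtype.ext (map_smul (FibreAlgebra.twist (outCenter G σ)) r x.1)

/-- The algebra `kB^{Z(G)}(T) ⋊ Out(G)`: the direct sum of copies of `kB^{Z(G)}(T)` indexed by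
`Out(G)`, with the product `v_τ u_σ = (v τ(u))_{τσ}`. The element `u_σ` is
`SkewMonoidAlgebra.single σ u`. -/
abbrev CrossedMonomial : Type (max (u + 1) w) :=
  SkewMonoidAlgebra (MonomialBurnside k T (Subgroup.center G)) (OuterAut G)

variable {G T}

/-- The subgroup `D_{σ,α,X} = {(α(t) σ(g), g, t) | g ∈ G, t ∈ X}` of `G × G × T`. -/
def twistedDiagonal (σ : MulAut G) (X : Subgroup T) (α : X →* Subgroup.center G) :
    Subgroup (G × G × T) where
  carrier := {s | ∃ (g : G) (t : X), s = ((α t : G) * σ g, g, (t : T))}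
  one_mem' := ⟨1, 1, by simp; rfl⟩
  mul_mem' := by
    rintro _ _ ⟨g, t, rfl⟩ ⟨g', t', rfl⟩
    refine ⟨g * g', t * t', ?_⟩
    have h := Subgroup.mem_center_iff.1 (α t').2 (σ g)
    simp only [Prod.mk_mul_mk, map_mul, Subgroup.coe_mul, Prod.mk.injEq, and_true]
    rw [mul_assoc, ← mul_assoc (σ g), h, mul_assoc, mul_assoc]
  inv_mem' := by
    rintro _ ⟨g, t, rfl⟩
    refine ⟨g⁻¹, t⁻¹, ?_⟩
    have h := Subgroup.mem_center_iff.1 (α t)⁻¹.2 (σ g)⁻¹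
    simpa using h

variable [Finite T]

/-- The class `[GGT / D_{σ,α,X}]` in `kB_T(G × G)`. -/
noncomputable def twistedDiagonalClass (σ : MulAut G) (X : Subgroup T)
    (α : X →* Subgroup.center G) : ShiftedEnd k G T :=
  ShiftedEnd.cls k (FinGSet.cosets (twistedDiagonal σ X α))

variable (G T)

/-- The set `𝓛_p` of the classes `[[GGT / D_{σ,α,X}]]` in the essential algebra. -/
def directProductClasses : Set (EssentialAlgebra k G T) :=
  {x | ∃ (σ : MulAut G) (X : Subgroup T) (α : X →* Subgroup.center G),
    x = essentialMap k G T (twistedDiagonalClass k σ X α)}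

end Crossed

/-!
The homomorphism `Φ` is given on sets by `[U]_σ ↦ [G_σ ×_Z U]`, where `Z = Z(G)`, `U` is a
`Z`-free `T × Z`-set, and `G_σ` is `G` with the action `(a, b, t) g = a g σ(b)⁻¹`. Written in this
way it is visibly linear in `[U]`; it depends only on the class of `σ` because `g ↦ g σ(c)⁻¹` is an
isomorphism `G_σ ≅ G_{σ c}`, where the index `c` also denotes conjugation by `c`; and it is
multiplicative because `([g, v], [h, u]) ↦ [g τ(h), [v, u]]` induces an isomorphism
`(G_τ ×_Z V) ×_G (G_σ ×_Z U) ≅ G_{τσ} ×_Z (V ×_Z τ(U))` (`centerInduced.prod_iso`). The stabilizer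
of `[1, X_α]` in `G_σ ×_Z (T × Z) / X_α` is `D_{σ,α,X}`, which gives the values of `Φ` on the
classes `[X, α]_σ`.

Both injectivity statements come from an explicit left inverse, so that no basis of the Burnside
module is needed. For `τ ∈ Aut(G)`, the points of a `G × G × T`-set whose stabilizer contains
`Δ_τ(G) = {(τ(g), g, 1)}` and meets `G × 1 × 1` trivially form a `T × Z`-set; passing to this set is
additive and so defines a linear map `diagonalRestriction τ : kB_T(G × G) → kB(T × Z)`. Two
computations finish the proof.

* On `G_σ ×_Z U` these points are a copy of `U` if `τ` and `σ` agree in `Out(G)`, and there are none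
  otherwise. Hence `diagonalRestriction τ (Φ x)` is the component of `x` at the class of `τ`
  (`diagonalRestriction_crossedInduction`).
* On a composite `X ×_K Y` with `|K| < |G|` there are no such points
  (`card_le_of_isDiagonalPoint`). As `I_T(G)` is additively generated by composites of this kind,
  `diagonalRestriction τ` vanishes on it, and the left inverse factors through the essential
  algebra.

For the image it remains to know that the classes `[X, α]` span `kB^Z(T)`
(`MonomialBurnside.span_transitive`): every `A`-set is a sum of orbits, and a stabilizer of a point
of a `Z`-free `T × Z`-set meets `1 × Z` trivially, hence is the graph of a homomorphism.
-/

/-! ### Finite `A`-sets: orbits, invariant subsets, generation by transitive sets -/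

namespace FinGSet

variable {A : Type u} [Group A]

/-- The invariant subset of an `A`-set cut out by a predicate that is stable under `A`. -/
def sub (X : FinGSet A) (p : X → Prop) (hp : ∀ (a : A) (x : X), p x → p (a • x)) : FinGSet A :=
  letI : MulAction A {x : X // p x} :=
    { smul := fun a x => ⟨a • x.1, hp a x.1 x.2⟩
      one_smul := fun x => Subtype.ext (one_smul A x.1)
      mul_smul := fun a b x => Subtype.ext (mul_smul a b x.1) }
  ⟨{x : X // p x}⟩

/-- The orbit-stabilizer theorem: if `x₀` generates `X` and has stabilizer `D`, then
`X ≅ A / D`. -/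
theorem iso_cosets [Finite A] {X : FinGSet A} (D : Subgroup A) (x₀ : X)
    (hgen : ∀ x : X, ∃ a : A, a • x₀ = x) (hstab : ∀ a : A, a • x₀ = x₀ ↔ a ∈ D) :
    Iso X (cosets D) := by
  refine Iso.of_surj (W := A) (fun a => a • x₀) (fun a => (QuotientGroup.mk a : A ⧸ D)) hgen
    QuotientGroup.mk_surjective (fun a b => ?_) (fun a b => ⟨a * b, mul_smul a b x₀, rfl⟩)
  change _ ↔ (QuotientGroup.mk a : A ⧸ D) = QuotientGroup.mk b
  rw [QuotientGroup.eq, ← hstab, mul_smul, inv_smul_eq_iff]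
  exact eq_comm

theorem exists_generator_cosets [Finite A] (D : Subgroup A) : ∃ x₀ : cosets D,
    (∀ x : cosets D, ∃ a : A, a • x₀ = x) ∧ ∀ a : A, a • x₀ = x₀ ↔ a ∈ D := by
  refine ⟨(QuotientGroup.mk 1 : A ⧸ D), fun x => ?_, fun a => ?_⟩
  · obtain ⟨a, rfl⟩ := QuotientGroup.mk_surjective (s := D) x
    exact ⟨a, congrArg (QuotientGroup.mk (s := D)) (mul_one a)⟩
  · change (QuotientGroup.mk (a * 1) : A ⧸ D) = QuotientGroup.mk 1 ↔ _
    rw [eq_comm, QuotientGroup.eq]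
    simp

/-- An `A`-set is the disjoint union of an invariant subset and its complement. -/
theorem sub_sum_iso (X : FinGSet A) (p : X → Prop) (hp : ∀ (a : A) (x : X), p x → p (a • x))
    (hn : ∀ (a : A) (x : X), ¬ p x → ¬ p (a • x)) :
    Iso ((X.sub p hp).sum (X.sub (fun x => ¬ p x) hn)) X := by
  classical
  exact ⟨Equiv.sumCompl p, fun a x => by rcases x with x | x <;> rfl⟩

end FinGSet

namespace Burnside

variable {k : Type w} [CommRing k] {A : Type u} [Group A]

theorem cls_of_isEmpty (X : FinGSet A) (hX : IsEmpty X) : cls k X = 0 := by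
  have h : FinGSet.Iso (X.sum X) X := by
    refine ⟨@Equiv.equivOfIsEmpty _ _ (inferInstanceAs (IsEmpty (X ⊕ X))) hX, fun a x => ?_⟩
    rcases x with x | x <;> exact hX.elim x
  have := (cls_eq (k := k) h).symm.trans (cls_sum X X)
  simpa using this

/-- Every class is a sum of classes of transitive sets `A / Stab(x)`, by splitting off one orbit
at a time. -/
theorem cls_mem_span_cosets [Finite A] (X : FinGSet A) :
    cls k X ∈ Submodule.span k
      (Set.range fun x : X => cls k (FinGSet.cosets (MulAction.stabilizer A x))) := by
  induction h : Nat.card X using Nat.strong_induction_on generalizing X with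
  | _ n ih =>
  rcases isEmpty_or_nonempty X with hX | ⟨⟨x₀⟩⟩
  · rw [cls_of_isEmpty X hX]
    exact zero_mem _
  have hp : ∀ (a : A) (x : X), x ∈ MulAction.orbit A x₀ → a • x ∈ MulAction.orbit A x₀ := by
    rintro a _ ⟨b, rfl⟩
    exact ⟨a * b, mul_smul a b x₀⟩
  have hn : ∀ (a : A) (x : X), x ∉ MulAction.orbit A x₀ → a • x ∉ MulAction.orbit A x₀ := by
    intro a x hx h
    have := hp a⁻¹ _ h
    rw [inv_smul_smul] at this
    exact hx this
  rw [← cls_eq (X.sub_sum_iso (· ∈ MulAction.orbit A x₀) hp hn), cls_sum]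
  refine add_mem ?_ ?_
  · refine Submodule.subset_span ⟨x₀, (cls_eq (FinGSet.iso_cosets _ ?_ ?_ ?_)).symm⟩
    · exact (⟨x₀, MulAction.mem_orbit_self x₀⟩ : {x : X // x ∈ MulAction.orbit A x₀})
    · rintro ⟨x, a, rfl⟩
      exact ⟨a, rfl⟩
    · intro a
      exact Subtype.ext_iff
  · refine Submodule.span_mono ?_ (ih _ ?_ _ rfl)
    · rintro _ ⟨⟨x, hx⟩, rfl⟩
      refine ⟨x, ?_⟩
      have : MulAction.stabilizer A x = MulAction.stabilizer A
          (show X.sub (· ∉ MulAction.orbit A x₀) hn from ⟨x, hx⟩) :=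
        Subgroup.ext fun a => (Subtype.ext_iff
          (a1 := (⟨a • x, hn a x hx⟩ : {x : X // x ∉ MulAction.orbit A x₀}))
          (a2 := ⟨x, hx⟩)).symm
      exact congrArg (fun D => cls k (FinGSet.cosets D)) this
    · rw [← h]
      exact Finite.card_subtype_lt (p := (· ∉ MulAction.orbit A x₀)) (x := x₀)
        (not_not.2 (MulAction.mem_orbit_self x₀))

end Burnside

/-! ### The monomial Burnside ring is spanned by the classes `[X, α]` -/

section MonomialSpan

variable {T C : Type u} [Group T] [CommGroup C]

/-- A subgroup of `T × C` that meets `1 × C` trivially is the graph of a homomorphism. -/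
theorem exists_eq_graphSubgroup (S : Subgroup (T × C))
    (hS : ∀ c : C, ((1, c) : T × C) ∈ S → c = 1) :
    ∃ (X : Subgroup T) (α : X →* C), S = graphSubgroup X α := by
  have inj : Function.Injective ((MonoidHom.fst T C).subgroupMap S) := by
    rw [injective_iff_map_eq_one]
    rintro ⟨⟨t, c⟩, h⟩ h1
    obtain rfl : t = 1 := congrArg Subtype.val h1
    obtain rfl := hS c h
    rfl
  let e : S ≃* S.map (MonoidHom.fst T C) :=
    MulEquiv.ofBijective _ ⟨inj, (MonoidHom.fst T C).subgroupMap_surjective S⟩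
  refine ⟨S.map (MonoidHom.fst T C),
    (MonoidHom.snd T C).comp (S.subtype.comp e.symm.toMonoidHom), Subgroup.ext fun s => ?_⟩
  constructor
  · intro hs
    refine ⟨e ⟨s, hs⟩, ?_⟩
    change ((e ⟨s, hs⟩ : T), (e.symm (e ⟨s, hs⟩)).1.2) = s
    rw [MulEquiv.symm_apply_apply]
    rfl
  · rintro ⟨x, rfl⟩
    obtain ⟨s, rfl⟩ := e.surjective x
    change ((e s : T), (e.symm (e s)).1.2) ∈ S
    rw [MulEquiv.symm_apply_apply]
    exact s.2

variable {k : Type w} [CommRing k] [Finite C]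

/-- To check a property of all elements of `kB^C(T)` that is stable under linear combinations, it
is enough to check it on the classes of `C`-fibred `T`-sets. -/
theorem MonomialBurnside.mem_of_cls (N : Submodule k (MonomialBurnside k T C))
    (h : ∀ U hU, cls k U hU ∈ N) (x : MonomialBurnside k T C) : x ∈ N := by
  obtain ⟨x, hx⟩ := x
  have hx' : x ∈ Submodule.span k
      {x | ∃ X : FinGSet (T × C), IsFibred X ∧ x = FibreAlgebra.cls k X} := hx
  suffices h : ∃ hx : x ∈ monomialBurnside k T C, (⟨x, hx⟩ : MonomialBurnside k T C) ∈ N from h.2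
  clear hx
  induction hx' using Submodule.span_induction with
  | mem x hx =>
    obtain ⟨U, hU, rfl⟩ := hx
    exact ⟨_, h U hU⟩
  | zero => exact ⟨zero_mem _, N.zero_mem⟩
  | add x y _ _ h1 h2 =>
    obtain ⟨h1, h1''⟩ := h1
    obtain ⟨h2, h2''⟩ := h2
    exact ⟨add_mem h1 h2, N.add_mem h1'' h2''⟩
  | smul r x _ h1 =>
    obtain ⟨h1, h1''⟩ := h1
    exact ⟨Subalgebra.smul_mem _ h1 r, N.smul_mem r h1''⟩

/-- Two linear maps on `kB^C(T)` that agree on classes of `C`-fibred `T`-sets are equal. -/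
theorem MonomialBurnside.hom_ext {M : Type*} [AddCommGroup M] [Module k M]
    {f g : MonomialBurnside k T C →ₗ[k] M} (h : ∀ U hU, f (cls k U hU) = g (cls k U hU)) : f = g :=
  LinearMap.ext fun x => mem_of_cls (LinearMap.eqLocus f g) h x

theorem MonomialBurnside.span_transitive [Finite T] :
    Submodule.span k {x : MonomialBurnside k T C |
      ∃ (X : Subgroup T) (α : X →* C), x = transitive k X α} = ⊤ := by
  refine eq_top_iff.2 fun x _ => mem_of_cls _ (fun U hU => ?_) x
  let ι : MonomialBurnside k T C →ₗ[k] Burnside k (T × C) := (val k).toLinearMap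
  have hι : Function.Injective ι := Subtype.val_injective
  suffices h : ι (cls k U hU) ∈ Submodule.map ι (Submodule.span k
      {x | ∃ (X : Subgroup T) (α : X →* C), x = transitive k X α}) by
    obtain ⟨y, hy, h⟩ := h
    rwa [← hι h]
  rw [Submodule.map_span]
  refine Submodule.span_mono ?_ (Burnside.cls_mem_span_cosets U)
  rintro _ ⟨x, rfl⟩
  obtain ⟨X, α, h⟩ := exists_eq_graphSubgroup (MulAction.stabilizer (T × C) x) fun c hc => hU c x hc
  refine ⟨transitive k X α, ⟨X, α, rfl⟩, ?_⟩
  dsimp only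
  rw [h]
  rfl

end MonomialSpan

/-! ### The bisets `G_σ ×_Z U` -/

section Induction

variable {k : Type w} [CommRing k] {G T : Type u} [Group G] [Group T] [Finite G]

variable (T) in
/-- The `G × G × T`-set `G_σ`: the set `G` with `(a, b, t) g = a g σ(b)⁻¹`. -/
def twistedUnit (σ : MulAut G) : FinGSet (G × G × T) :=
  (diagUnit G T).res ((MonoidHom.id G).prodMap (σ.toMonoidHom.prodMap (MonoidHom.id T)))

variable (G T) in
/-- The balancing over `Z = Z(G)` that defines `G_σ ×_Z U` for a `T × Z`-set `U`: `z` sends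
`(g, u)` to `(z⁻¹ g, z u)`, and `(a, b, t) [g, u] = [(a, b, t) g, t u]`. -/
def centerBalancing :
    Balancing (Subgroup.center G) (G × G × T) (T × Subgroup.center G) (G × G × T) where
  midL := { toFun := fun z => ((z : G)⁻¹, 1, 1)
            map_one' := by simp
            map_mul' := fun z w => by
              rw [mul_comm z w]
              simp }
  midR := { toFun := fun z => (1, z), map_one' := rfl, map_mul' := by simp }
  actL := MonoidHom.id _
  actR := { toFun := fun s => (s.2.2, 1), map_one' := rfl, map_mul' := by simp }
  commL := fun z s => by
    ext
    · exact (Subgroup.mem_center_iff.1 (z⁻¹).2 s.1).symm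
    · simp
    · simp
  commR := by simp

/-- The `G × G × T`-set `G_σ ×_Z U`. -/
def centerInduced (σ : MulAut G) (U : FinGSet (T × Subgroup.center G)) : FinGSet (G × G × T) :=
  (centerBalancing G T).prod (twistedUnit T σ) U

/-- The element `[g, u]` of `G_σ ×_Z U`. -/
def centerInduced.pt (σ : MulAut G) {U : FinGSet (T × Subgroup.center G)} (g : G) (u : U) :
    centerInduced σ U :=
  (centerBalancing G T).pt (X := twistedUnit T σ) g u

namespace centerInduced

variable {σ τ : MulAut G} {U V : FinGSet (T × Subgroup.center G)}

theorem pt_surj (x : centerInduced σ U) : ∃ g u, x = pt σ g u :=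
  Balancing.pt_surj _ x

theorem pt_eq {g g' : G} {u u' : U} : pt σ g u = pt σ g' u' ↔
    ∃ z : Subgroup.center G, (z : G)⁻¹ * g = g' ∧ ((1, z) : T × Subgroup.center G) • u = u' := by
  refine (Balancing.pt_eq _).trans (exists_congr fun z => and_congr_left' ?_)
  change (z : G)⁻¹ * g * (σ 1)⁻¹ = g' ↔ _
  simp

theorem smul_pt (a b : G) (t : T) (g : G) (u : U) :
    ((a, b, t) : G × G × T) • pt σ g u =
      pt σ (a * g * (σ b)⁻¹) (((t, 1) : T × Subgroup.center G) • u) := rfl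

/-- `G_σ ×_Z ((T × Z) / X_α)` is the transitive set `(G × G × T) / D_{σ,α,X}`. -/
theorem iso_cosets_twistedDiagonal [Finite T] (σ : MulAut G) (X : Subgroup T)
    (α : X →* Subgroup.center G) :
    FinGSet.Iso (centerInduced σ (FinGSet.cosets (graphSubgroup X α)))
      (FinGSet.cosets (twistedDiagonal σ X α)) := by
  obtain ⟨u₀, hgen, hstab⟩ := FinGSet.exists_generator_cosets (graphSubgroup X α)
  refine FinGSet.iso_cosets _ (pt σ 1 u₀) ?_ ?_
  · intro x
    obtain ⟨g, u, rfl⟩ := pt_surj x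
    obtain ⟨⟨t, z⟩, rfl⟩ := hgen u
    refine ⟨(g * z, 1, t), ?_⟩
    rw [smul_pt, pt_eq]
    refine ⟨z, ?_, ?_⟩
    · have := Subgroup.mem_center_iff.1 z.2 g
      simp [this]
    · rw [smul_smul]
      simp
  · rintro ⟨a, b, t⟩
    rw [smul_pt, pt_eq]
    simp only [smul_smul, Prod.mk_mul_mk, one_mul, mul_one, hstab]
    constructor
    · rintro ⟨z, h1, x, hx⟩
      have hx1 : (x : T) = t := congrArg Prod.fst hx
      have hx2 : α x = z := congrArg Prod.snd hx
      refine ⟨b, x, ?_⟩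
      have : (z : G)⁻¹ * a = σ b := by
        rw [← mul_inv_eq_one, mul_assoc, h1]
      rw [hx1, hx2, ← this, mul_inv_cancel_left]
    · rintro ⟨g, x, h⟩
      simp only [Prod.mk.injEq] at h
      obtain ⟨rfl, rfl, rfl⟩ := h
      exact ⟨α x, by simp, x, rfl⟩

/-- The multiplication rule of the crossed product, on the level of sets. -/
theorem prod_iso (τ σ : MulAut G) (V U : FinGSet (T × Subgroup.center G)) :
    FinGSet.Iso ((diagBalancing G G G T).prod (centerInduced τ V) (centerInduced σ U))
      (centerInduced (τ * σ)
        ((fibreBalancing T (Subgroup.center G)).prod V (U.twist (autCenter G τ)))) := by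
  refine FinGSet.Iso.of_surj (W := (G × V) × (G × U))
    (fun w => (diagBalancing G G G T).pt (pt τ w.1.1 w.1.2) (pt σ w.2.1 w.2.2))
    (fun w => pt (τ * σ) (w.1.1 * τ w.2.1) ((fibreBalancing T (Subgroup.center G)).pt w.1.2
      (Y := U.twist (autCenter G τ)) w.2.2)) ?_ ?_ ?_ ?_
  · intro x
    obtain ⟨x, y, rfl⟩ := Balancing.pt_surj _ x
    obtain ⟨g, v, rfl⟩ := pt_surj x
    obtain ⟨h, u, rfl⟩ := pt_surj y
    exact ⟨((g, v), (h, u)), rfl⟩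
  · intro x
    obtain ⟨g, y, rfl⟩ := pt_surj x
    obtain ⟨v, u, rfl⟩ := Balancing.pt_surj _ y
    exact ⟨((g, v), (1, u)), by simp⟩
  · rintro ⟨⟨g, v⟩, ⟨h, u⟩⟩ ⟨⟨g', v'⟩, ⟨h', u'⟩⟩
    have hL : (diagBalancing G G G T).pt (pt τ g v) (pt σ h u) =
        (diagBalancing G G G T).pt (pt τ g' v') (pt σ h' u') ↔
        ∃ (l : G) (z w : Subgroup.center G), (z : G)⁻¹ * (g * (τ l)⁻¹) = g' ∧
          ((1, z) : T × Subgroup.center G) • v = v' ∧ (w : G)⁻¹ * (l * h) = h' ∧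
          ((1, w) : T × Subgroup.center G) • u = u' := by
      refine (Balancing.pt_eq _).trans (exists_congr fun l => ?_)
      change ((1, l, 1) : G × G × T) • pt τ g v = pt τ g' v' ∧
        ((l, 1, 1) : G × G × T) • pt σ h u = pt σ h' u' ↔ _
      simp only [smul_pt, pt_eq, smul_smul, Prod.mk_mul_mk, mul_one, one_mul, map_one, inv_one]
      constructor
      · rintro ⟨⟨z, h1, h2⟩, ⟨w, h3, h4⟩⟩
        exact ⟨z, w, h1, h2, h3, h4⟩
      · rintro ⟨z, w, h1, h2, h3, h4⟩
        exact ⟨⟨z, h1, h2⟩, ⟨w, h3, h4⟩⟩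
    have hR : pt (τ * σ) (g * τ h) ((fibreBalancing T (Subgroup.center G)).pt v
          (Y := U.twist (autCenter G τ)) u) =
        pt (τ * σ) (g' * τ h') ((fibreBalancing T (Subgroup.center G)).pt v'
          (Y := U.twist (autCenter G τ)) u') ↔
        ∃ y c : Subgroup.center G, (y : G)⁻¹ * (g * τ h) = g' * τ h' ∧
          ((1, c⁻¹ * y) : T × Subgroup.center G) • v = v' ∧
          ((1, (autCenter G τ)⁻¹ c) : T × Subgroup.center G) • u = u' := by
      refine pt_eq.trans (exists_congr fun y => ?_)
      refine (and_congr_right' (Balancing.pt_eq _)).trans (exists_and_left.symm.trans ?_)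
      refine exists_congr fun c => and_congr_right' (and_congr ?_ ?_)
      · change ((1, c⁻¹) : T × Subgroup.center G) • ((1, y) : T × Subgroup.center G) • v = v' ↔ _
        simp [smul_smul]
      · change ((1, (autCenter G τ)⁻¹ c) : T × Subgroup.center G) •
          ((1, (autCenter G τ)⁻¹ 1) : T × Subgroup.center G) • u = u' ↔ _
        simp [smul_smul]
    refine hL.trans (Iff.trans ?_ hR.symm)
    constructor
    · rintro ⟨l, z, w, rfl, h2, rfl, h4⟩
      refine ⟨autCenter G τ w * z, autCenter G τ w, ?_, ?_, ?_⟩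
      · have hw := Subgroup.mem_center_iff.1 (autCenter G τ w)⁻¹.2
        have hw' : ((autCenter G τ w : Subgroup.center G) : G) = τ w := rfl
        simp only [Subgroup.coe_inv, hw', Subgroup.coe_mul, mul_inv_rev, map_mul, map_inv] at hw ⊢
        rw [← mul_assoc _ (τ _)⁻¹, hw]
        simp only [← mul_assoc, hw, inv_mul_cancel_right]
      · simpa using h2
      · simpa using h4
    · rintro ⟨y, c, h1, h2, h3⟩
      obtain ⟨w, rfl⟩ := (autCenter G τ).surjective c
      -- `l h = w h'` forces `l`, and then `z` is forced by `c⁻¹ y = z`.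
      refine ⟨w * h' * h⁻¹, (autCenter G τ w)⁻¹ * y, w, ?_, h2, by simp [mul_assoc],
        by simpa using h3⟩
      have hw := Subgroup.mem_center_iff.1 (autCenter G τ w).2
      have hw' : ((autCenter G τ w : Subgroup.center G) : G) = τ w := rfl
      have hy := Subgroup.mem_center_iff.1 (y⁻¹).2
      have h1' : g' = (y : G)⁻¹ * (g * τ h) * (τ h')⁻¹ := by rw [h1]; group
      rw [hw'] at hw
      rw [h1']
      simp only [Subgroup.coe_mul, Subgroup.coe_inv, hw', mul_inv_rev, inv_inv, map_mul, map_inv]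
      simp only [mul_assoc]
      rw [← hw]
      simp [mul_assoc]
  · rintro ⟨a, b, t⟩ ⟨⟨g, v⟩, ⟨h, u⟩⟩
    refine ⟨((a * g, ((t, 1) : T × Subgroup.center G) • v),
      (h * (σ b)⁻¹, ((t, 1) : T × Subgroup.center G) • u)), ?_, ?_⟩
    · change _ = (diagBalancing G G G T).pt (((a, 1, t) : G × G × T) • pt τ g v)
        (((1, b, t) : G × G × T) • pt σ h u)
      simp [smul_pt]
    · change _ = pt (τ * σ) (a * (g * τ h) * (τ (σ b))⁻¹)
        ((fibreBalancing T (Subgroup.center G)).pt (((t, 1) : T × Subgroup.center G) • v)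
          (Y := U.twist (autCenter G τ)) (((t, (autCenter G τ)⁻¹ 1) : T × Subgroup.center G) • u))
      simp [mul_assoc]

/-- `G_1 ×_Z Z ≅ G`. -/
theorem one_iso (G T : Type u) [Group G] [Group T] [Finite G] :
    FinGSet.Iso (centerInduced 1 (fibreUnit T (Subgroup.center G))) (diagUnit G T) := by
  refine FinGSet.Iso.of_surj (W := G × Subgroup.center G)
    (fun w => pt 1 w.1 (show fibreUnit T (Subgroup.center G) from w.2))
    (fun w => (w.1 * w.2 : G)) ?_ ?_ ?_ ?_
  · intro x
    obtain ⟨g, u, rfl⟩ := pt_surj x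
    exact ⟨(g, u), rfl⟩
  · intro g
    exact ⟨(g, 1), mul_one (show G from g)⟩
  · rintro ⟨g, u⟩ ⟨g', u'⟩
    refine pt_eq.trans ⟨?_, fun h => ⟨u' * u⁻¹, ?_, inv_mul_cancel_right u' u⟩⟩
    · rintro ⟨z, rfl, h2⟩
      have h2 : z * u = u' := h2
      have hz := Subgroup.mem_center_iff.1 (z⁻¹).2 g
      simp only [Subgroup.coe_inv] at hz
      subst h2
      change g * (u : G) = (z : G)⁻¹ * g * ((z : G) * u)
      rw [← hz, mul_assoc, inv_mul_cancel_left]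
    · have h : g * (u : G) = g' * u' := h
      have hz := Subgroup.mem_center_iff.1 ((u' * u⁻¹)⁻¹).2 g
      rw [Subgroup.coe_inv] at hz
      rw [← hz, ← Subgroup.coe_inv, mul_inv_rev, inv_inv, Subgroup.coe_mul, ← mul_assoc, h]
      simp
  · rintro ⟨a, b, t⟩ ⟨g, u⟩
    refine ⟨(a * g * b⁻¹, u), ?_, ?_⟩
    · exact congrArg (pt 1 _) (one_mul u).symm
    · change a * g * b⁻¹ * (u : G) = a * (g * u) * b⁻¹
      rw [mul_assoc, Subgroup.mem_center_iff.1 u.2]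
      simp only [mul_assoc]

end centerInduced

/-- Composing `σ` with an inner automorphism does not change `G_σ` up to isomorphism. -/
theorem twistedUnit_mul_conj (σ : MulAut G) (c : G) :
    FinGSet.Iso (twistedUnit T σ) (twistedUnit T (σ * MulAut.conj c)) := by
  refine ⟨(Equiv.mulRight (σ c)⁻¹ : G ≃ G), ?_⟩
  rintro ⟨a, b, t⟩ (g : G)
  change a * g * (σ b)⁻¹ * (σ c)⁻¹ = a * (g * (σ c)⁻¹) * (σ (c * b * c⁻¹))⁻¹
  simp [mul_assoc]

/-- The linear map `kB(T × Z) → kB_T(G × G)` with `[U] ↦ [G_σ ×_Z U]`. It depends only on the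
class of `σ` in `Out(G)`. -/
noncomputable def centerInduction (σ : OuterAut G) :
    FibreAlgebra k T (Subgroup.center G) →ₗ[k] ShiftedEnd k G T :=
  Quotient.liftOn' σ
    (fun σ => (centerBalancing G T).bilin k (Burnside.cls k (twistedUnit T σ)))
    (fun σ τ h => by
      obtain ⟨c, hc⟩ := QuotientGroup.leftRel_apply.1 h
      obtain rfl : σ * MulAut.conj c = τ := by rw [hc, mul_inv_cancel_left]
      exact congrArg ((centerBalancing G T).bilin k) (Burnside.cls_eq (twistedUnit_mul_conj σ c)))

theorem centerInduction_cls (σ : MulAut G) (U : FinGSet (T × Subgroup.center G)) :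
    centerInduction (QuotientGroup.mk σ) (FibreAlgebra.cls k U) =
      ShiftedEnd.cls k (centerInduced σ U) :=
  Balancing.bilin_cls _ _ _ _

theorem centerInduction_one :
    centerInduction 1 (1 : FibreAlgebra k T (Subgroup.center G)) = (1 : ShiftedEnd k G T) :=
  (centerInduction_cls 1 _).trans (Burnside.cls_eq (centerInduced.one_iso G T))

theorem centerInduction_mul (τ σ : OuterAut G) (y x : FibreAlgebra k T (Subgroup.center G)) :
    centerInduction τ y * centerInduction σ x =
      centerInduction (τ * σ) (y * FibreAlgebra.twist (outCenter G τ) x) := by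
  obtain ⟨τ, rfl⟩ := QuotientGroup.mk_surjective τ
  obtain ⟨σ, rfl⟩ := QuotientGroup.mk_surjective σ
  let F : FibreAlgebra k T (Subgroup.center G) →ₗ[k] FibreAlgebra k T (Subgroup.center G) →ₗ[k]
      ShiftedEnd k G T :=
    (LinearMap.mul k (ShiftedEnd k G T)).compl₁₂ (centerInduction (QuotientGroup.mk τ))
      (centerInduction (QuotientGroup.mk σ))
  let F' : FibreAlgebra k T (Subgroup.center G) →ₗ[k] FibreAlgebra k T (Subgroup.center G) →ₗ[k]
      ShiftedEnd k G T :=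
    ((LinearMap.mul k (FibreAlgebra k T (Subgroup.center G))).compl₂
      (FibreAlgebra.twist (outCenter G (QuotientGroup.mk τ)))).compr₂
      (centerInduction (QuotientGroup.mk τ * QuotientGroup.mk σ))
  suffices h : F = F' from DFunLike.congr_fun (DFunLike.congr_fun h y) x
  refine Burnside.hom_ext fun V => Burnside.hom_ext fun U => ?_
  change centerInduction (QuotientGroup.mk τ) (FibreAlgebra.cls k V) *
    centerInduction (QuotientGroup.mk σ) (FibreAlgebra.cls k U) =
    centerInduction (QuotientGroup.mk (τ * σ)) (FibreAlgebra.cls k V *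
      FibreAlgebra.twist (autCenter G τ) (FibreAlgebra.cls k U))
  rw [FibreAlgebra.twist_cls, FibreAlgebra.cls_mul_cls, centerInduction_cls, centerInduction_cls,
    centerInduction_cls]
  exact (ShiftedBurnside.comp_cls k _ _).trans
    (Burnside.cls_eq (centerInduced.prod_iso τ σ V U))

variable (k G T) in
/-- The linear map underlying `Φ`, with `[U]_σ ↦ [G_σ ×_Z U]`. -/
noncomputable def crossedInductionLinear : CrossedMonomial k G T →ₗ[k] ShiftedEnd k G T :=
  (Finsupp.lsum k fun σ : OuterAut G =>
    (centerInduction σ).comp (MonomialBurnside.val k).toLinearMap).comp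
    (SkewMonoidAlgebra.coeffLinearEquiv (S := k)).toLinearMap

theorem crossedInductionLinear_single (σ : OuterAut G)
    (x : MonomialBurnside k T (Subgroup.center G)) :
    crossedInductionLinear k G T (SkewMonoidAlgebra.single σ x) =
      centerInduction σ (MonomialBurnside.val k x) := by
  exact Finsupp.sum_single_index
    (map_zero (centerInduction σ ∘ₗ (MonomialBurnside.val k).toLinearMap))

variable (k G T) in
/-- The algebra homomorphism `Φ : kB^Z(T) ⋊ Out(G) → kB_T(G × G)`, `[U]_σ ↦ [G_σ ×_Z U]`. -/
noncomputable def crossedInduction : CrossedMonomial k G T →ₐ[k] ShiftedEnd k G T :=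
  AlgHom.ofLinearMap (crossedInductionLinear k G T)
    (by
      rw [SkewMonoidAlgebra.one_def, crossedInductionLinear_single, map_one]
      exact centerInduction_one)
    (fun y x => by
      induction y using SkewMonoidAlgebra.induction_on with
      | zero => rw [zero_mul, map_zero, zero_mul]
      | add y y' h h' => rw [add_mul, map_add, map_add, h, h', add_mul]
      | single τ v =>
      induction x using SkewMonoidAlgebra.induction_on with
      | zero => rw [mul_zero, map_zero, mul_zero]
      | add x x' h h' => rw [mul_add, map_add, map_add, h, h', mul_add]
      | single σ u =>
      rw [SkewMonoidAlgebra.single_mul_single, crossedInductionLinear_single,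
        crossedInductionLinear_single, crossedInductionLinear_single, centerInduction_mul, map_mul]
      rfl)

theorem crossedInduction_single (σ : OuterAut G) (x : MonomialBurnside k T (Subgroup.center G)) :
    crossedInduction k G T (SkewMonoidAlgebra.single σ x) =
      centerInduction σ (MonomialBurnside.val k x) :=
  crossedInductionLinear_single σ x

theorem crossedInduction_transitive [Finite T] (σ : MulAut G) (X : Subgroup T)
    (α : X →* Subgroup.center G) :
    crossedInduction k G T (SkewMonoidAlgebra.single (QuotientGroup.mk σ : OuterAut G)
      (MonomialBurnside.transitive k X α)) = twistedDiagonalClass k σ X α := by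
  rw [crossedInduction_single]
  exact (centerInduction_cls σ _).trans
    (Burnside.cls_eq (centerInduced.iso_cosets_twistedDiagonal σ X α))

end Induction

/-! ### The `Δ_σ(G)`-fixed points, and the left inverse of `Φ` -/

section Fixed

variable {k : Type w} [CommRing k] {G T : Type u} [Group G] [Group T]

variable (G T) in
/-- The homomorphism `T × Z(G) → G × G × T`, `(t, z) ↦ (z, 1, t)`. Its image centralizes all the
twisted diagonals `Δ_σ(G) = {(σ(g), g, 1)}`. -/
def centerEmbedding : T × Subgroup.center G →* G × G × T where
  toFun s := (s.2, 1, s.1)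
  map_one' := rfl
  map_mul' := by simp

/-- The stabilizer of `x` contains `Δ_σ(G)` and meets `G × 1 × 1` trivially. These are the points
whose stabilizer is one of the groups `D_{σ,α,X}` with this `σ`. -/
def IsDiagonalPoint (σ : MulAut G) {X : FinGSet (G × G × T)} (x : X) : Prop :=
  (∀ g : G, ((σ g, g, 1) : G × G × T) • x = x) ∧ ∀ a : G, ((a, 1, 1) : G × G × T) • x = x → a = 1

theorem IsDiagonalPoint.smul {σ : MulAut G} {X : FinGSet (G × G × T)} (s : T × Subgroup.center G)
    {x : X} (hx : IsDiagonalPoint σ x) : IsDiagonalPoint σ (centerEmbedding G T s • x) := by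
  have comm : ∀ a b : G, ((a, b, 1) : G × G × T) * centerEmbedding G T s =
      centerEmbedding G T s * (a, b, 1) := by
    intro a b
    have := Subgroup.mem_center_iff.1 s.2.2 a
    ext <;> simp [centerEmbedding, this]
  refine ⟨fun g => ?_, fun a ha => hx.2 a ?_⟩
  · rw [smul_smul, comm, mul_smul, hx.1]
  · rwa [smul_smul, comm, mul_smul, smul_left_cancel_iff] at ha

theorem isDiagonalPoint_iff_of_injective {σ : MulAut G} {X Y : FinGSet (G × G × T)} (f : X → Y)
    (hf : Function.Injective f) (hs : ∀ (s : G × G × T) x, f (s • x) = s • f x) (x : X) :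
    IsDiagonalPoint σ (f x) ↔ IsDiagonalPoint σ x := by
  simp only [IsDiagonalPoint, ← hs, hf.eq_iff]

/-- The `T × Z`-set of diagonal points of `X` for `σ`, with `(t, z) x = (z, 1, t) x`. -/
def diagonalPart (σ : MulAut G) (X : FinGSet (G × G × T)) : FinGSet (T × Subgroup.center G) :=
  (X.res (centerEmbedding G T)).sub (IsDiagonalPoint σ (X := X)) fun s _ hx => hx.smul s

theorem diagonalPart_iso {σ : MulAut G} {X Y : FinGSet (G × G × T)} (h : FinGSet.Iso X Y) :
    FinGSet.Iso (diagonalPart σ X) (diagonalPart σ Y) := by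
  obtain ⟨e, he⟩ := h
  exact ⟨e.subtypeEquiv fun x => (isDiagonalPoint_iff_of_injective e e.injective he x).symm,
    fun s x => Subtype.ext (he _ x.1)⟩

theorem diagonalPart_sum (σ : MulAut G) (X Y : FinGSet (G × G × T)) :
    FinGSet.Iso (diagonalPart σ (X.sum Y)) ((diagonalPart σ X).sum (diagonalPart σ Y)) := by
  have hl : ∀ x : X, IsDiagonalPoint σ (X := X.sum Y) (Sum.inl x) ↔ IsDiagonalPoint σ x :=
    isDiagonalPoint_iff_of_injective (Y := X.sum Y) _ Sum.inl_injective fun _ _ => rfl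
  have hr : ∀ y : Y, IsDiagonalPoint σ (X := X.sum Y) (Sum.inr y) ↔ IsDiagonalPoint σ y :=
    isDiagonalPoint_iff_of_injective (Y := X.sum Y) _ Sum.inr_injective fun _ _ => rfl
  refine ⟨Equiv.subtypeSum.trans
    (Equiv.sumCongr (Equiv.subtypeEquivRight hl) (Equiv.subtypeEquivRight hr)), ?_⟩
  rintro s ⟨x | y, h⟩ <;> rfl

/-- The linear map `kB_T(G × G) → kB(T × Z)` sending the class of `X` to the class of its set of
diagonal points for `σ`. -/
noncomputable def diagonalRestriction (σ : MulAut G) :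
    ShiftedEnd k G T →ₗ[k] FibreAlgebra k T (Subgroup.center G) :=
  Burnside.lift (fun X => Burnside.cls k (diagonalPart σ X))
    (fun _ _ h => Burnside.cls_eq (diagonalPart_iso h))
    (fun X Y => (Burnside.cls_eq (diagonalPart_sum σ X Y)).trans (Burnside.cls_sum _ _))

theorem diagonalRestriction_cls (σ : MulAut G) (X : FinGSet (G × G × T)) :
    diagonalRestriction σ (ShiftedEnd.cls k X) = FibreAlgebra.cls k (diagonalPart σ X) :=
  Burnside.lift_cls ..

/-- A composite through `K` has a diagonal point only if `|G| ≤ |K|`: if `Δ_σ(G)` fixes `[x, y]`,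
then choosing for each `g` an element `h ∈ K` with `(σ(g), h, 1) x = x` and `(h, g, 1) y = y` gives
an injection of `G` into `K`. -/
theorem card_le_of_isDiagonalPoint {K : Type u} [Group K] [Finite K] {σ : MulAut G}
    {X : FinGSet (G × K × T)} {Y : FinGSet (K × G × T)} {p : (diagBalancing G K G T).prod X Y}
    (hp : IsDiagonalPoint σ p) : Nat.card G ≤ Nat.card K := by
  obtain ⟨x, y, rfl⟩ := Balancing.pt_surj _ p
  have h1 : ∀ g : G, ∃ h : K, ((1, h, 1) : G × K × T) • ((σ g, 1, 1) : G × K × T) • x = x ∧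
      ((h, 1, 1) : K × G × T) • ((1, g, 1) : K × G × T) • y = y := fun g =>
    (Balancing.pt_eq _).1 (hp.1 g)
  simp only [smul_smul, Prod.mk_mul_mk, mul_one, one_mul] at h1
  choose f hf _ using h1
  refine Nat.card_le_card_of_injective f fun g g' hgg => ?_
  have e1 : ((σ g', f g', 1) : G × K × T)⁻¹ • ((σ g, f g', 1) : G × K × T) • x = x := by
    rw [inv_smul_eq_iff, hf g', ← hgg, hf g]
  have e2 : ((σ g'⁻¹ * σ g, 1, 1) : G × K × T) • x = x := by
    simpa [smul_smul] using e1
  have e3 : ((σ g'⁻¹ * σ g, 1, 1) : G × G × T) • (diagBalancing G K G T).pt x y =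
      (diagBalancing G K G T).pt x y :=
    congrArg₂ (diagBalancing G K G T).pt e2 (one_smul (K × G × T) y)
  have := hp.2 _ e3
  rw [← map_mul, EmbeddingLike.map_eq_one_iff, inv_mul_eq_one] at this
  exact this.symm

theorem diagonalRestriction_comp_of_card_lt {K : Type u} [Group K] [Finite K]
    (hK : Nat.card K < Nat.card G) (σ : MulAut G) (a : ShiftedBurnside k G K T)
    (b : ShiftedBurnside k K G T) :
    diagonalRestriction σ (ShiftedBurnside.comp k a b : ShiftedEnd k G T) = 0 := by
  let F : ShiftedBurnside k G K T →ₗ[k] ShiftedBurnside k K G T →ₗ[k]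
      FibreAlgebra k T (Subgroup.center G) :=
    (ShiftedBurnside.comp k).compr₂ (diagonalRestriction σ)
  suffices h : F = 0 from LinearMap.congr_fun₂ h a b
  refine Burnside.hom_ext fun X => Burnside.hom_ext fun Y => ?_
  change diagonalRestriction σ (ShiftedBurnside.comp k (Burnside.cls k X) (Burnside.cls k Y)) = 0
  rw [ShiftedBurnside.comp_cls]
  refine (diagonalRestriction_cls σ _).trans (Burnside.cls_of_isEmpty _ ⟨fun p => ?_⟩)
  exact hK.not_ge (card_le_of_isDiagonalPoint p.2)

variable [Finite G]

theorem diagonalRestriction_of_mem_essentialIdeal (σ : MulAut G) {x : ShiftedEnd k G T}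
    (hx : x ∈ essentialIdeal k G T) : diagonalRestriction σ x = 0 := by
  rw [essentialIdeal, TwoSidedIdeal.mem_span_iff_mem_addSubgroup_closure_absorbing] at hx
  · induction hx using AddSubgroup.closure_induction with
    | mem x hx =>
      obtain ⟨K, _, _, hK, a, b, rfl⟩ := hx
      exact diagonalRestriction_comp_of_card_lt hK σ a b
    | zero => exact map_zero _
    | add x y _ _ h1 h2 => rw [map_add, h1, h2, add_zero]
    | neg x _ h => rw [map_neg, h, neg_zero]
  · rintro x _ ⟨K, _, _, hK, a, b, rfl⟩
    exact ⟨K, _, ‹_›, hK, ShiftedBurnside.comp k (G := G) (H := G) x a, b,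
      (ShiftedBurnside.comp_assoc k (G := G) (H := G) x a b).symm⟩
  · rintro _ y ⟨K, _, _, hK, a, b, rfl⟩
    exact ⟨K, _, ‹_›, hK, a, ShiftedBurnside.comp k (K := G) b y,
      ShiftedBurnside.comp_assoc k a b (y : ShiftedBurnside k G G T)⟩

namespace centerInduced

variable {σ τ : MulAut G} {U : FinGSet (T × Subgroup.center G)}

/-- By freeness, `Δ_τ(G)` fixes `[g, u] ∈ G_σ ×_Z U` only if `τ = c_g σ`, where `c_g` is
conjugation by `g`. -/
theorem eq_conj_mul_of_fixed (hU : IsFibred U) {g : G} {u : U}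
    (h : ∀ b : G, ((τ b, b, 1) : G × G × T) • pt σ g u = pt σ g u) :
    τ = MulAut.conj g * σ := by
  ext b
  have hb := h b
  rw [smul_pt, pt_eq] at hb
  obtain ⟨z, h1, h2⟩ := hb
  obtain rfl : z = 1 := hU z u (by simpa [smul_smul] using h2)
  simp only [Subgroup.coe_one, inv_one, one_mul] at h1
  change τ b = g * σ b * g⁻¹
  rw [← mul_inv_eq_iff_eq_mul.1 h1, mul_inv_cancel_right]

theorem isDiagonalPoint_pt_one (hU : IsFibred U) (u : U) : IsDiagonalPoint σ (pt σ 1 u) := by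
  refine ⟨fun g => ?_, fun a ha => ?_⟩
  · rw [smul_pt]
    have h : ((1, 1) : T × Subgroup.center G) • u = u := one_smul _ u
    rw [h, mul_one, mul_inv_cancel]
  · rw [smul_pt, pt_eq] at ha
    obtain ⟨z, h1, h2⟩ := ha
    obtain rfl : z = 1 := hU z u (by simpa [smul_smul] using h2)
    simpa using h1

/-- The diagonal points for `σ` of `G_σ ×_Z U` are the points `[1, u]`, so they form a copy
of `U`. -/
theorem diagonalPart_self (hU : IsFibred U) :
    FinGSet.Iso U (diagonalPart σ (centerInduced σ U)) := by
  refine ⟨Equiv.ofBijective (fun u => ⟨pt σ 1 u, isDiagonalPoint_pt_one hU u⟩) ⟨?_, ?_⟩, ?_⟩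
  · intro u u' h
    obtain ⟨z, h1, h2⟩ := pt_eq.1 (congrArg Subtype.val h)
    obtain rfl : z = 1 := by simpa using h1
    exact (one_smul _ u).symm.trans h2
  · rintro ⟨x, hx⟩
    obtain ⟨g, u, rfl⟩ := pt_surj x
    have hg : g ∈ Subgroup.center G := by
      have h := eq_conj_mul_of_fixed hU hx.1
      rw [Subgroup.mem_center_iff]
      intro a
      have := DFunLike.congr_fun h (σ⁻¹ a)
      simp only [MulAut.mul_apply, MulAut.apply_inv_self, MulAut.conj_apply] at this
      exact eq_mul_inv_iff_mul_eq.1 this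
    refine ⟨((1, ⟨g, hg⟩) : T × Subgroup.center G) • u, Subtype.ext (pt_eq.2 ⟨⟨g, hg⟩⁻¹, ?_, ?_⟩)⟩
    · simp
    · rw [smul_smul, Prod.mk_mul_mk, mul_one, inv_mul_cancel]
      exact one_smul _ u
  · rintro ⟨t, z⟩ u
    refine Subtype.ext ?_
    change pt σ 1 (((t, z) : T × Subgroup.center G) • u) =
      (((z : G), 1, t) : G × G × T) • pt σ 1 u
    rw [smul_pt, pt_eq]
    exact ⟨z⁻¹, by simp, by simp [smul_smul]⟩

end centerInduced

/-- The diagonal points for `τ` recover the component of an element of `kB^Z(T) ⋊ Out(G)` at the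
class of `τ` from its image under `Φ`. -/
theorem diagonalRestriction_crossedInduction (τ : MulAut G) (x : CrossedMonomial k G T) :
    diagonalRestriction τ (crossedInduction k G T x) =
      MonomialBurnside.val k (x.coeff (QuotientGroup.mk τ)) := by
  classical
  induction x using SkewMonoidAlgebra.induction_on with
  | zero => simp
  | add x y hx hy => rw [map_add, map_add, hx, hy, SkewMonoidAlgebra.coeff_add, Finsupp.add_apply,
      map_add]
  | single σ x =>
  obtain ⟨σ, rfl⟩ := QuotientGroup.mk_surjective σ
  rw [crossedInduction_single, SkewMonoidAlgebra.coeff_single_apply]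
  have key : ∀ f : MonomialBurnside k T (Subgroup.center G) →ₗ[k]
      FibreAlgebra k T (Subgroup.center G),
      (∀ U hU, FibreAlgebra.cls k (diagonalPart τ (centerInduced σ U)) =
        f (MonomialBurnside.cls k U hU)) →
      diagonalRestriction τ (centerInduction (QuotientGroup.mk σ) (MonomialBurnside.val k x)) =
        f x := by
    intro f hf
    refine LinearMap.congr_fun (f := ((diagonalRestriction τ).comp
      (centerInduction (QuotientGroup.mk σ))).comp (MonomialBurnside.val k).toLinearMap)
      (MonomialBurnside.hom_ext fun U hU => ?_) x
    rw [← hf U hU]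
    change diagonalRestriction τ (centerInduction (QuotientGroup.mk σ) (FibreAlgebra.cls k U)) = _
    rw [centerInduction_cls, diagonalRestriction_cls]
  split_ifs with h
  · refine key (MonomialBurnside.val k).toLinearMap fun U hU => ?_
    -- Representatives of the same class in `Out(G)` give isomorphic sets `G_σ ×_Z U`.
    have e : ShiftedEnd.cls k (centerInduced σ U) = ShiftedEnd.cls k (centerInduced τ U) := by
      rw [← centerInduction_cls, h, centerInduction_cls]
    rw [← diagonalRestriction_cls, e, diagonalRestriction_cls]
    exact (Burnside.cls_eq (centerInduced.diagonalPart_self hU)).symm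
  · rw [map_zero]
    refine key 0 fun U hU => Burnside.cls_of_isEmpty _ ⟨fun p => h ?_⟩
    obtain ⟨p, hp⟩ := p
    obtain ⟨g, u, rfl⟩ := centerInduced.pt_surj p
    obtain rfl := centerInduced.eq_conj_mul_of_fixed hU hp.1
    have hg : (QuotientGroup.mk (MulAut.conj g) : OuterAut G) = 1 :=
      (QuotientGroup.eq_one_iff _).2 ⟨g, rfl⟩
    rw [QuotientGroup.mk_mul, hg, one_mul]

theorem crossedInduction_injective_mod_essentialIdeal :
    Function.Injective ((essentialMap k G T).comp (crossedInduction k G T)) := by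
  rw [injective_iff_map_eq_zero]
  intro x hx
  have hx : crossedInduction k G T x ∈ essentialIdeal k G T :=
    TwoSidedIdeal.mem_asIdeal.1 (Ideal.Quotient.eq_zero_iff_mem.1 hx)
  ext τ
  obtain ⟨τ, rfl⟩ := QuotientGroup.mk_surjective τ
  refine Subtype.val_injective ?_
  refine (diagonalRestriction_crossedInduction τ x).symm.trans ?_
  rw [diagonalRestriction_of_mem_essentialIdeal τ hx]
  rfl

/-! ### The image in the essential algebra -/

variable (k G T) in
theorem range_crossedInduction_eq_span [Finite T] :
    Subalgebra.toSubmodule ((essentialMap k G T).comp (crossedInduction k G T)).range =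
      Submodule.span k (directProductClasses k G T) := by
  have gen : ∀ (σ : MulAut G) (X : Subgroup T) (α : X →* Subgroup.center G),
      (essentialMap k G T).comp (crossedInduction k G T)
        (SkewMonoidAlgebra.single (QuotientGroup.mk σ : OuterAut G)
          (MonomialBurnside.transitive k X α)) =
      essentialMap k G T (twistedDiagonalClass k σ X α) := fun σ X α =>
    congrArg (essentialMap k G T) (crossedInduction_transitive σ X α)
  refine le_antisymm ?_ (Submodule.span_le.2 ?_)
  · rintro _ ⟨x, rfl⟩
    change (essentialMap k G T).comp (crossedInduction k G T) x ∈ _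
    induction x using SkewMonoidAlgebra.induction_on with
    | zero => rw [map_zero]; exact zero_mem _
    | add x y hx hy => rw [map_add]; exact add_mem hx hy
    | single σ x =>
    obtain ⟨σ, rfl⟩ := QuotientGroup.mk_surjective σ
    have hx : x ∈ Submodule.span k {x : MonomialBurnside k T (Subgroup.center G) |
        ∃ (X : Subgroup T) (α : X →* Subgroup.center G), x = .transitive k X α} := by
      rw [MonomialBurnside.span_transitive]
      trivial
    induction hx using Submodule.span_induction with
    | mem x hx =>
      obtain ⟨X, α, rfl⟩ := hx
      rw [gen]
      exact Submodule.subset_span ⟨σ, X, α, rfl⟩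
    | zero => rw [SkewMonoidAlgebra.single_zero, map_zero]; exact zero_mem _
    | add x y _ _ hx hy => rw [SkewMonoidAlgebra.single_add, map_add]; exact add_mem hx hy
    | smul r x _ hx =>
      rw [← SkewMonoidAlgebra.smul_single, map_smul]
      exact Submodule.smul_mem _ r hx
  · rintro _ ⟨σ, X, α, rfl⟩
    exact ⟨_, gen σ X α⟩

end Fixed

theorem theorem3p4 (k : Type w) [CommRing k] (G T : Type u) [Group G] [Finite G]
    [Group T] [Finite T] :
    ∃ Φ : CrossedMonomial k G T →ₐ[k] ShiftedEnd k G T,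
      (∀ (σ : MulAut G) (X : Subgroup T) (α : X →* Subgroup.center G),
        Φ (SkewMonoidAlgebra.single (QuotientGroup.mk σ : OuterAut G)
            (MonomialBurnside.transitive k X α)) = twistedDiagonalClass k σ X α) ∧
      Function.Injective Φ ∧
      Function.Injective ((essentialMap k G T).comp Φ) ∧
      ((essentialMap k G T).comp Φ).range = Algebra.adjoin k (directProductClasses k G T) ∧
      Subalgebra.toSubmodule ((essentialMap k G T).comp Φ).range =
        Submodule.span k (directProductClasses k G T) := by
  have inj := crossedInduction_injective_mod_essentialIdeal (k := k) (G := G) (T := T)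
  have span := range_crossedInduction_eq_span k G T
  refine ⟨crossedInduction k G T, crossedInduction_transitive,
    Function.Injective.of_comp (f := essentialMap k G T) inj, inj, ?_, span⟩
  refine le_antisymm ?_ (Algebra.adjoin_le fun x hx => ?_)
  · rw [← Subalgebra.toSubmodule.le_iff_le, span]
    exact Algebra.span_le_adjoin k _
  · rw [SetLike.mem_coe, ← Subalgebra.mem_toSubmodule, span]
    exact Submodule.subset_span hx
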